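/- **Notation.** Let $a\in\mathbb{R}$, let $H_n(t)=(-1)^n e^{t^2}\frac{d^n}{dt^n}e^{-t^2}$ be the Hermite polynomials, and for $n\ge 0$ put $$P_{n,a}(t)=H_n(t)\begin{pmatrix}1&0\\0&1\end{pmatrix}+nH_{n-1}(t)\begin{pmatrix}0&-a\\-a&a^2t\end{pmatrix}$$ (the second term is $0$ for $n=0$), and $$W_a(t)=e^{-t^2}\begin{pmatrix}1&at\\0&1\end{pmatrix}\begin{pmatrix}1&0\\at&1\end{pmatrix}.$$ For a $2\times2$ matrix polynomial $y$ define $$\mathcal{A}_1(y)=-y\,P_{1,a}'+y'\,(P_{1,a}')^{-1}P_{1,a}P_{1,a}',\qquad \mathcal{P}_{1,n,a}=\mathcal{A}_1(P_{n,a}),$$ $$\mathcal{A}_2(y)=y\,A_{2,0}+y'\,A_{2,1},\quad A_{2,0}=-\begin{pmatrix}\frac12&0\\0&\frac1{a^2+2}\end{pmatrix},\quad A_{2,1}=-(\mathcal{P}_{1,2,a}')^{-1}\mathcal{P}_{1,2,a}A_{2,0},\qquad \mathcal{P}_{2,n,a}=\mathcal{A}_2(\mathcal{P}_{1,n,a}),$$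 where $A_{2,1}$ is a matrix of rational functions (the inverses exist, since the determinants are not identically $0$). Put $\mathfrak p(t)=4(a^2+2)t^4+8t^2+3a^2+2$ and $$\mathcal{W}(t)=\frac{e^{-t^{2}}}{\mathfrak p^{2}(t)}\begin{pmatrix} \frac{(a^2+2)[(a^{2}t^{2}+3a^{2}+1)\mathfrak p(t)+a^{2}(3a^{2}+2)(2t^{2}-3)]}{(3a^2+2)^2} & \frac{at(\mathfrak p(t)+8((a^{2}+2)t^{2}+1))}{3a^{2}+2} \\ \frac{at(\mathfrak p(t)+8((a^{2}+2)t^{2}+1))}{3a^{2}+2} & \frac{\mathfrak p(t) + 2a^{2}\left(\frac{6(a^{2}+2)t^{2}}{3a^{2}+2}-1\right)}{a^2+2}\end{pmatrix}.$$ For a matrix function $V$ on $\mathbb{R}$ write $\langle P,Q\rangle_V=\int_{\mathbb R}P(t)V(t)Q(t)^{*}\,dt$ and $\|P\|_V^2=\langle P,P\rangle_V$. **Theorem.** For every $a\in\mathbb{R}$ the matrices $\mathcal{P}_{2,n,a}$ have polynomial entries, and $\mathcal{P}_{2,n,a}$, $n=0,3,4,\dots$, are exceptional matrix polynomials with gaps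 $\{1,2\}$ with respect to $\mathcal{W}(t)\,dt$. That is: 1. for $n=0,3,4,\dots$, $\mathcal{P}_{2,n,a}$ has degree $n$ with nonsingular leading coefficient; 2. $\mathcal{W}(t)\,dt$ is a weight matrix: it has finite moments of every order, $\int_\Omega\mathcal W(t)\,dt$ is positive semidefinite for every Borel set $\Omega$ and positive definite for at least one, and its support is infinite; 3. $\langle\mathcal{P}_{2,n,a},\mathcal{P}_{2,k,a}\rangle_{\mathcal W}=0$ for $n\ne k$, and $\|\mathcal{P}_{2,n,a}\|^2_{\mathcal W}$ is positive definite ($n,k\in\{0,3,4,\dots\}$); 4. the finite linear combinations $\sum_n A_n\mathcal{P}_{2,n,a}$, $n\in\{0,3,4,\dots\}$, $A_n\in\mathbb{R}^{2\times2}$, are dense in $L^2(\mathcal{W})$, the space of measurable $F:\mathbb{R}\to\mathbb{R}^{2\times2}$ with $\int\operatorname{tr}(F\mathcal{W}F^*)\,dt<\infty$; 5. there are matrices $\mathcal F_2\neq0,\mathcal F_1,\mathcal F_0$ of rational functions and constant matrices $\Gamma_n$ such that, for $n=0,3,4,\dots$, $$\mathcal{P}_{2,n,a}''\mathcal F_2+\mathcal{P}_{2,n,a}'\mathcal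 F_1+\mathcal{P}_{2,n,a}\mathcal F_0=\Gamma_n\mathcal{P}_{2,n,a}.$$ Moreover, for $n=0,3,4,\dots$, $$\Vert \mathcal{P}_{2,n,a}\Vert _{\mathcal{W}}^2=(n-1)(n-2)\begin{pmatrix}\frac{1}{4(3a^2+2)^2}&0\\0&\frac{1}{4(3a^2+2)(a^2+2)}\end{pmatrix}\Vert P_{n,a}\Vert _{W_{a}}^2,$$ where, for every $n\ge0$, $$\Vert P_{n,a}\Vert _{W_{a}}^2=\sqrt{\pi}\,2^n\,n!\begin{pmatrix}1+\frac{a^2(n+1)}2&0\\0&1+\frac{a^2n}2\end{pmatrix}.$$ -/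

import Mathlib

open Polynomial MeasureTheory

noncomputable section

namespace ExcMatrix

/-! ### Weight matrices with a density, and exceptional matrix polynomials -/

/-- Matrix polynomials of size `N` with real coefficients. -/
abbrev MatPoly (N : ℕ) := Matrix (Fin N) (Fin N) ℝ[X]

/-- The value at `t` of a matrix polynomial. -/
def evalAt {N : ℕ} (P : MatPoly N) (t : ℝ) : Matrix (Fin N) (Fin N) ℝ :=
  P.map (fun p => p.eval t)

/-- The (entrywise) derivative of a matrix polynomial. -/
def deriv {N : ℕ} (P : MatPoly N) : MatPoly N :=
  P.map (fun p => derivative p)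

/-- A matrix polynomial, seen as a matrix of rational functions. -/
def toRat {N : ℕ} (P : MatPoly N) : Matrix (Fin N) (Fin N) (RatFunc ℝ) :=
  P.map (algebraMap ℝ[X] (RatFunc ℝ))

/-- A constant matrix, seen as a matrix of rational functions. -/
def constRat {N : ℕ} (A : Matrix (Fin N) (Fin N) ℝ) : Matrix (Fin N) (Fin N) (RatFunc ℝ) :=
  A.map (fun x => RatFunc.C x)

/-- `P` has degree `n` and its leading coefficient (the matrix coefficient of `t ^ n`)
is nonsingular. -/
def HasNonsingularLeading {N : ℕ} (P : MatPoly N) (n : ℕ) : Prop :=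
  (∀ i j, (P i j).natDegree ≤ n) ∧ IsUnit (P.map (fun p => p.coeff n)).det

/-- The value on the set `S` of the matrix of measures `W(t) dt`. -/
def massOn {N : ℕ} (W : ℝ → Matrix (Fin N) (Fin N) ℝ) (S : Set ℝ) :
    Matrix (Fin N) (Fin N) ℝ :=
  Matrix.of fun i j => ∫ t in S, W t i j

/-- `W(t) dt` is a weight matrix: it has finite moments of every order, it is a positive definite
matrix of measures (positive semidefinite on every Borel set and positive definite
on at least one Borel set), and its support is infinite. -/
structure IsWeightMatrix {N : ℕ} (W : ℝ → Matrix (Fin N) (Fin N) ℝ) : Prop where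
  moments : ∀ (n : ℕ) (i j : Fin N), Integrable (fun t => t ^ n * W t i j)
  posSemidef : ∀ S : Set ℝ, MeasurableSet S → (massOn W S).PosSemidef
  posDef : ∃ S : Set ℝ, MeasurableSet S ∧ (massOn W S).PosDef
  support : {x : ℝ | ∀ ε > 0, massOn W (Set.Ioo (x - ε) (x + ε)) ≠ 0}.Infinite

/-- The matrix-valued form `⟨P, Q⟩ = ∫ P(t) W(t) Q(t)ᵀ dt`. -/
def gram {N : ℕ} (W : ℝ → Matrix (Fin N) (Fin N) ℝ) (P Q : MatPoly N) :
    Matrix (Fin N) (Fin N) ℝ :=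
  Matrix.of fun i j => ∫ t, (evalAt P t * W t * (evalAt Q t).transpose) i j

/-- The squared norm `∫ tr (F(t) W(t) F(t)ᵀ) dt` of `L²(W)`, with values in `[0, ∞]`. -/
def sqNorm {N : ℕ} (W F : ℝ → Matrix (Fin N) (Fin N) ℝ) : ENNReal :=
  ∫⁻ t, ENNReal.ofReal (F t * W t * (F t).transpose).trace

/-- `F` is (a representative of) an element of `L²(W)`. -/
def MemL2 {N : ℕ} (W F : ℝ → Matrix (Fin N) (Fin N) ℝ) : Prop :=
  (∀ i j, AEMeasurable (fun t => F t i j)) ∧ sqNorm W F < ⊤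

/-- The linear combinations `∑ Aₙ Pₙ` (finite sums over `n ∉ X`, with constant matrices `Aₙ`
multiplying from the left) are dense in `L²(W)`. -/
def IsCompleteIn {N : ℕ} (X : Finset ℕ) (P : ℕ → MatPoly N)
    (W : ℝ → Matrix (Fin N) (Fin N) ℝ) : Prop :=
  ∀ F : ℝ → Matrix (Fin N) (Fin N) ℝ, MemL2 W F → ∀ ε : ℝ, 0 < ε →
    ∃ (s : Finset ℕ) (A : ℕ → Matrix (Fin N) (Fin N) ℝ), Disjoint s X ∧
      sqNorm W (fun t => F t - ∑ n ∈ s, A n * evalAt (P n) t) < ENNReal.ofReal ε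

/-- The polynomials `P n`, `n ∉ X`, are exceptional matrix polynomials
with respect to the weight matrix `W(t) dt`. -/
structure IsExceptional {N : ℕ} (X : Finset ℕ) (P : ℕ → MatPoly N)
    (W : ℝ → Matrix (Fin N) (Fin N) ℝ) : Prop where
  degree : ∀ n ∉ X, HasNonsingularLeading (P n) n
  weight : IsWeightMatrix W
  orthogonal : ∀ n ∉ X, ∀ k ∉ X, n ≠ k → gram W (P n) (P k) = 0
  norm_posDef : ∀ n ∉ X, (gram W (P n) (P n)).PosDef
  complete : IsCompleteIn X P W
  /-- left eigenfunctions of one second order operator `y ↦ y'' F₂ + y' F₁ + y F₀` acting from the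
  right, with rational coefficients -/
  eigen : ∃ F₂ F₁ F₀ : Matrix (Fin N) (Fin N) (RatFunc ℝ), F₂ ≠ 0 ∧
    ∃ Γ : ℕ → Matrix (Fin N) (Fin N) ℝ, ∀ n ∉ X,
      toRat (deriv (deriv (P n))) * F₂ + toRat (deriv (P n)) * F₁ + toRat (P n) * F₀
        = constRat (Γ n) * toRat (P n)

/-! ### The Hermite type family -/

/-- The (physicists') Hermite polynomials `Hₙ`; see `H_rodrigues`. -/
def H : ℕ → ℝ[X]
  | 0 => 1
  | n + 1 => 2 * X * H n - derivative (H n)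

/-- `Hₙ(t) = (-1)ⁿ exp(t²) (d/dt)ⁿ exp(-t²)`. -/
theorem H_rodrigues (n : ℕ) (t : ℝ) :
    (H n).eval t
      = (-1) ^ n * Real.exp (t ^ 2) * iteratedDeriv n (fun s => Real.exp (-s ^ 2)) t := by
  have key : ∀ n : ℕ, iteratedDeriv n (fun s : ℝ => Real.exp (-s ^ 2))
      = fun t => (-1) ^ n * ((H n).eval t * Real.exp (-t ^ 2)) := by
    intro n
    induction n with
    | zero => funext t; simp [H]
    | succ n ih =>
      rw [iteratedDeriv_succ, ih]
      funext t
      have h1 : HasDerivAt (fun s : ℝ => Real.exp (-s ^ 2)) (Real.exp (-t ^ 2) * (-(2 * t))) t := by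
        have h0 : HasDerivAt (fun s : ℝ => -s ^ 2) (-(2 * t)) t := by
          have h00 := (hasDerivAt_pow 2 t).neg
          simp only [Nat.cast_ofNat, Nat.add_one_sub_one, pow_one] at h00
          exact h00
        exact h0.exp
      have h2 := (((H n).hasDerivAt t).mul h1).const_mul ((-1 : ℝ) ^ n)
      refine h2.deriv.trans ?_
      simp only [H, eval_sub, eval_mul, eval_X, eval_ofNat, pow_succ]
      ring
  rw [key n]
  have h3 : Real.exp (t ^ 2) * Real.exp (-t ^ 2) = 1 := by
    rw [← Real.exp_add]; simp
  have h4 : ((-1 : ℝ) ^ n) * (-1) ^ n = 1 := by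
    rw [← mul_pow]; simp
  linear_combination (-(H n).eval t) * h3 - (Real.exp (t ^ 2) * Real.exp (-t ^ 2)
    * (H n).eval t) * h4

/-- `P_{n,a} = Hₙ I + n H_{n-1} [[0, -a], [-a, a² t]]`. -/
def P (a : ℝ) (n : ℕ) : MatPoly 2 :=
  H n • (1 : MatPoly 2) + ((n : ℝ[X]) * H (n - 1)) • !![0, -C a; -C a, C (a ^ 2) * X]

/-- `W_a(t) = exp(-t²) exp(At) exp(Aᵀt)`, with `A = [[0, a], [0, 0]]` (so `A² = 0` and
`exp(At) = [[1, at], [0, 1]]`). -/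
def W (a t : ℝ) : Matrix (Fin 2) (Fin 2) ℝ :=
  Real.exp (-t ^ 2) • (!![1, a * t; 0, 1] * (!![1, a * t; 0, 1]).transpose)

/-! ### The two steps of the quasi-Darboux transformation -/

/-- The first step `y ↦ - y P₁' + y' (P₁')⁻¹ P₁ P₁'`, with seed `P₁ = P_{1,a}`. Here `P₁'` is
an invertible constant matrix, see `isUnit_det_deriv_P_one`. -/
def stepOne (a : ℝ) (y : MatPoly 2) : MatPoly 2 :=
  -(y * deriv (P a 1)) + deriv y * ((deriv (P a 1))⁻¹ * P a 1 * deriv (P a 1))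

/-- `𝒫_{1,n,a}`. -/
def P₁ (a : ℝ) (n : ℕ) : MatPoly 2 := stepOne a (P a n)

/-- The constant coefficient `A_{2,0}` of the second step. -/
def A₂₀ (a : ℝ) : Matrix (Fin 2) (Fin 2) (RatFunc ℝ) :=
  constRat (-!![1 / 2, 0; 0, 1 / (a ^ 2 + 2)])

/-- The second step `y ↦ y A_{2,0} + y' A_{2,1}`, `A_{2,1} = -(𝒫₁₂')⁻¹ 𝒫₁₂ A_{2,0}`, with
seed `𝒫₁₂ = 𝒫_{1,2,a}`. The inverse is that of an invertible matrix of rational functions, see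
`isUnit_det_deriv_P₁_two`. -/
def stepTwo (a : ℝ) (y : MatPoly 2) : Matrix (Fin 2) (Fin 2) (RatFunc ℝ) :=
  toRat y * A₂₀ a
    + toRat (deriv y) * (-((toRat (deriv (P₁ a 2)))⁻¹ * toRat (P₁ a 2) * A₂₀ a))

/-- `𝒫_{2,n,a}`, a priori a matrix of rational functions. -/
def P₂ (a : ℝ) (n : ℕ) : Matrix (Fin 2) (Fin 2) (RatFunc ℝ) := stepTwo a (P₁ a n)

/-- `𝔭(t) = 4 (a² + 2) t⁴ + 8 t² + 3 a² + 2`. -/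
def pp (a t : ℝ) : ℝ := 4 * (a ^ 2 + 2) * t ^ 4 + 8 * t ^ 2 + 3 * a ^ 2 + 2

/-- The density `𝒲` of the exceptional weight matrix. -/
def excW (a t : ℝ) : Matrix (Fin 2) (Fin 2) ℝ :=
  (Real.exp (-t ^ 2) / pp a t ^ 2) •
    !![(a ^ 2 + 2) * ((a ^ 2 * t ^ 2 + (3 * a ^ 2 + 1)) * pp a t
          + a ^ 2 * (3 * a ^ 2 + 2) * (2 * t ^ 2 - 3)) / (3 * a ^ 2 + 2) ^ 2,
        a * t * (pp a t + 8 * ((a ^ 2 + 2) * t ^ 2 + 1)) / (3 * a ^ 2 + 2);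
      a * t * (pp a t + 8 * ((a ^ 2 + 2) * t ^ 2 + 1)) / (3 * a ^ 2 + 2),
        (pp a t + 2 * a ^ 2 * (6 * (a ^ 2 + 2) * t ^ 2 / (3 * a ^ 2 + 2) - 1)) / (a ^ 2 + 2)]

theorem P_one (a : ℝ) : P a 1 = !![C 2 * X, -C a; -C a, C (a ^ 2 + 2) * X] := by
  have h2 : (C 2 : ℝ[X]) = 2 := rfl
  ext1 i j
  fin_cases i <;> fin_cases j <;> simp [P, H, h2, -map_pow]
  ring

theorem P_two (a : ℝ) : P a 2 = !![4 * X ^ 2 - 2, -(4 * C a * X);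
    -(4 * C a * X), (4 + 4 * C (a ^ 2)) * X ^ 2 - 2] := by
  ext1 i j
  fin_cases i <;> fin_cases j <;> simp [P, H, -map_pow] <;> ring

theorem deriv_P_one (a : ℝ) : deriv (P a 1) = !![C 2, 0; 0, C (a ^ 2 + 2)] := by
  rw [P_one]
  ext1 i j
  fin_cases i <;> fin_cases j <;>
    simp only [deriv, Matrix.map_apply, Fin.zero_eta, Fin.mk_one, Matrix.of_apply,
      Matrix.cons_val_zero, Matrix.cons_val_one, derivative_C_mul, derivative_X, mul_one,
      derivative_neg, derivative_C, neg_zero]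

theorem isUnit_det_deriv_P_one (a : ℝ) : IsUnit (deriv (P a 1)).det := by
  rw [deriv_P_one, Matrix.det_fin_two_of, mul_zero, sub_zero, ← C_mul]
  exact isUnit_C.2 (isUnit_iff_ne_zero.2 (by positivity))

theorem inv_deriv_P_one (a : ℝ) :
    (deriv (P a 1))⁻¹ = !![C (1 / 2), 0; 0, C (1 / (a ^ 2 + 2))] := by
  apply Matrix.inv_eq_left_inv
  have hb : a ^ 2 + 2 ≠ 0 := by positivity
  rw [deriv_P_one, Matrix.mul_fin_two, Matrix.one_fin_two]
  simp only [mul_zero, zero_mul, add_zero, zero_add, ← C_mul]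
  rw [one_div_mul_cancel two_ne_zero, one_div_mul_cancel hb, C_1]

theorem isUnit_det_deriv_P₁_two (a : ℝ) : IsUnit (toRat (deriv (P₁ a 2))).det := by
  have h : (deriv (P₁ a 2)).det ≠ 0 := by
    have hb : a ^ 2 + 2 ≠ 0 := by positivity
    have he : ((deriv (P₁ a 2)).det).eval 1 = 64 * (1 + a ^ 2) * (a ^ 2 + 4) := by
      simp only [P₁, stepOne, inv_deriv_P_one]
      rw [deriv_P_one, P_one, P_two]
      simp only [deriv, Matrix.mul_fin_two, Matrix.det_fin_two, Matrix.map_apply, Matrix.add_apply,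
        Matrix.neg_apply, Matrix.of_apply, Matrix.cons_val_zero, Matrix.cons_val_one,
        Matrix.cons_val', Matrix.cons_val_fin_one]
      simp [Matrix.mul_apply, Fin.sum_univ_two, -map_pow, -map_add, -map_inv₀]
      field_simp
      ring
    intro h0
    rw [h0, eval_zero] at he
    have : 0 < 64 * (1 + a ^ 2) * (a ^ 2 + 4) := by positivity
    exact absurd he this.ne
  rw [isUnit_iff_ne_zero]
  have : (toRat (deriv (P₁ a 2))).det = algebraMap ℝ[X] (RatFunc ℝ) (deriv (P₁ a 2)).det :=
    (RingHom.map_det _ _).symm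
  rw [this]
  exact fun h0 => h ((map_eq_zero_iff _ (IsFractionRing.injective ℝ[X] (RatFunc ℝ))).1 h0)

end ExcMatrix

end

noncomputable section

namespace ExcMatrix

/-! ### Algebra of matrix polynomials -/

section MatPoly

variable {N : ℕ}

/-! The two Darboux steps compose to one operator `Rop a y = y + y' F₁ + y'' F₂` with polynomial
coefficients (`stepTwo_stepOne`), so the exceptional family is `Q a n = Rop a (P a n)`. Since `F₁' =
-1` and `F₂' = -F₁`, one has `(Rop a y)' = y''' F₂`. The seeds `P a 1` and `P a 2` are annihilated,
whence the gaps; in degree `n` the leading coefficient is multiplied by `(n - 1)(n - 2) / 2`.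

Differential equation: `Rop` intertwines the Hermite type operator of `P` with another one
(`Rop_intertwine`), in which `y'''` is rewritten as `(Rop a y)' F₂⁻¹`.

Orthogonality and norms: `F₂ 𝒲 F₂ᵀ` is a Gaussian times a polynomial matrix, and two integrations by
parts (`integrand_eq`) move `Rop` from the left argument to the right one. The resulting fourth
order operator acts on `P a n` as multiplication by a constant diagonal matrix (`adjoint_Q`), so the
Gram matrices of `Q` are those of `P` times that matrix (`gram_Q`). The Gram matrices of `P` reduce
to scalar Hermite orthogonality. Positivity of `𝒲` follows from one diagonal entry and from the
determinant of `F₂ 𝒲 F₂ᵀ`.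

Completeness: `16 (a² + 2) det F₂ = 𝔭`, so the derivative of `𝔭² w` is right divisible by `F₂`,
which puts `𝔭² w` in the range of `Rop` for every matrix polynomial `w` (`exists_Rop_eq_smul`). Such
products are dense, because polynomials are dense in `L²` of a measure with all exponential moments,
applied to `𝔭⁴ tr 𝒲 dt`. -/

theorem deriv_add (A B : MatPoly N) : deriv (A + B) = deriv A + deriv B := by
  ext1 i j; simp [deriv]

theorem deriv_neg (A : MatPoly N) : deriv (-A) = -deriv A := by
  ext1 i j; simp [deriv]

theorem deriv_zero : deriv (0 : MatPoly N) = 0 := by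
  ext1 i j; simp [deriv]

theorem deriv_mul (A B : MatPoly N) : deriv (A * B) = deriv A * B + A * deriv B := by
  ext1 i j
  simp [deriv, Matrix.mul_apply, Finset.sum_add_distrib]

theorem toRat_add (A B : MatPoly N) : toRat (A + B) = toRat A + toRat B := by
  ext1 i j; simp [toRat]

theorem toRat_neg (A : MatPoly N) : toRat (-A) = -toRat A := by
  ext1 i j; simp [toRat]

theorem toRat_mul (A B : MatPoly N) : toRat (A * B) = toRat A * toRat B :=
  Matrix.map_mul

theorem toRat_one : toRat (1 : MatPoly N) = 1 :=
  Matrix.map_one _ (map_zero _) (map_one _)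

theorem toRat_map_C (A : Matrix (Fin N) (Fin N) ℝ) : toRat (A.map C) = constRat A := by
  ext1 i j; simp [toRat, constRat]

theorem evalAt_add (A B : MatPoly N) (t : ℝ) : evalAt (A + B) t = evalAt A t + evalAt B t := by
  ext1 i j; simp [evalAt]

theorem evalAt_mul (A B : MatPoly N) (t : ℝ) : evalAt (A * B) t = evalAt A t * evalAt B t := by
  ext1 i j; simp [evalAt, Matrix.mul_apply, eval_finsetSum]

theorem evalAt_map_C (A : Matrix (Fin N) (Fin N) ℝ) (t : ℝ) : evalAt (A.map C) t = A := by
  ext1 i j; simp [evalAt]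

end MatPoly

/-! ### The composition of the two steps -/

/-- The coefficient of `y'` in the composition of the two steps. -/
def F₁ (a : ℝ) : MatPoly 2 := !![-X, C (a / 2); C (a / (a ^ 2 + 2)), -X]

/-- The coefficient of `y''` in the composition of the two steps. -/
def F₂ (a : ℝ) : MatPoly 2 :=
  !![C (1 / 2) * X ^ 2 + C ((3 * a ^ 2 + 2) / (4 * (a ^ 2 + 2))), -(C (a / 2) * X);
    -(C (a / (a ^ 2 + 2)) * X), C (1 / 2) * X ^ 2 + C (1 / 4)]

/-- The composition `y ↦ y + y' F₁ + y'' F₂` of the two steps. -/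
def Rop (a : ℝ) (y : MatPoly 2) : MatPoly 2 := y + deriv y * F₁ a + deriv (deriv y) * F₂ a

theorem deriv_F₁ (a : ℝ) : deriv (F₁ a) = -1 := by
  ext1 i j
  fin_cases i <;> fin_cases j <;> simp [deriv, F₁]

theorem deriv_F₂ (a : ℝ) : deriv (F₂ a) = -F₁ a := by
  ext1 i j
  refine Polynomial.funext fun t => ?_
  fin_cases i <;> fin_cases j <;> simp [deriv, F₁, F₂, one_add_one_eq_two]

/-- The terms in `y'` and `y''` cancel in pairs, because `F₁' = -1` and `F₂' = -F₁`. The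
intertwining relation, the adjoint computation and the description of the range all use this. -/
theorem deriv_Rop (a : ℝ) (y : MatPoly 2) :
    deriv (Rop a y) = deriv (deriv (deriv y)) * F₂ a := by
  simp only [Rop, deriv_add, deriv_mul, deriv_F₁, deriv_F₂]
  noncomm_ring

theorem Rop_add (a : ℝ) (y z : MatPoly 2) : Rop a (y + z) = Rop a y + Rop a z := by
  simp only [Rop, deriv_add]; noncomm_ring

theorem deriv_map_C {N : ℕ} (A : Matrix (Fin N) (Fin N) ℝ) : deriv (A.map C) = 0 := by
  ext1 i j; simp [deriv]

theorem Rop_map_C_mul (a : ℝ) (A : Matrix (Fin 2) (Fin 2) ℝ) (y : MatPoly 2) :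
    Rop a (A.map C * y) = A.map C * Rop a y := by
  simp only [Rop, deriv_mul, deriv_map_C, zero_mul, zero_add, mul_add, mul_assoc]

theorem deriv_deriv_P_two (a : ℝ) : deriv (deriv (P a 2)) = !![C 8, 0; 0, C (8 * (1 + a ^ 2))] := by
  rw [P_two]
  ext1 i j
  refine Polynomial.funext fun t => ?_
  fin_cases i <;> fin_cases j <;> simp [deriv, one_add_one_eq_two, -map_pow] <;> ring

/-- `(P₁')⁻¹ P₁ P₁'`. -/
def stepOneCoeff (a : ℝ) : MatPoly 2 := (deriv (P a 1))⁻¹ * P a 1 * deriv (P a 1)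

theorem deriv_stepOneCoeff (a : ℝ) : deriv (stepOneCoeff a) = deriv (P a 1) := by
  have h0 : deriv (deriv (P a 1)) = 0 := by
    rw [deriv_P_one]
    ext1 i j
    fin_cases i <;> fin_cases j <;> simp [deriv, -map_pow, -map_add]
  have h1 : deriv (deriv (P a 1))⁻¹ = 0 := by
    rw [inv_deriv_P_one]
    ext1 i j
    fin_cases i <;> fin_cases j <;> simp [deriv, -map_pow, -map_add, -map_inv₀]
  rw [stepOneCoeff, deriv_mul, deriv_mul, h0, h1, zero_mul, zero_add, mul_zero, add_zero,
    Matrix.nonsing_inv_mul _ (isUnit_det_deriv_P_one a), one_mul]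

/-- The derivative of `stepOneCoeff` is `P₁'`, so the two terms in `y'` cancel. -/
theorem deriv_stepOne (a : ℝ) (y : MatPoly 2) :
    deriv (stepOne a y) = deriv (deriv y) * stepOneCoeff a := by
  have h0 : deriv (deriv (P a 1)) = 0 := by
    rw [deriv_P_one]
    ext1 i j
    fin_cases i <;> fin_cases j <;> simp [deriv, -map_pow, -map_add]
  have : stepOne a y = -(y * deriv (P a 1)) + deriv y * stepOneCoeff a := rfl
  rw [this, deriv_add, deriv_neg, deriv_mul, deriv_mul, h0, deriv_stepOneCoeff]
  noncomm_ring

theorem deriv_fin_two (p q r s : ℝ[X]) :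
    deriv !![p, q; r, s] = !![derivative p, derivative q; derivative r, derivative s] := by
  ext1 i j
  fin_cases i <;> fin_cases j <;> rfl

/-- The diagonal matrix is the inverse of the constant `P₂''` of the seed `P a 2`. The left side is
what remains of `A_{2,1}` once the inverse of `stepOneCoeff` is removed from its left. -/
theorem seed_identity (a : ℝ) :
    -(!![C (1 / 8), 0; 0, C (1 / (8 * (1 + a ^ 2)))] * stepOne a (P a 2)
      * (-!![(1 / 2 : ℝ), 0; 0, 1 / (a ^ 2 + 2)]).map C) = F₂ a := by
  have hm : (-!![(1 / 2 : ℝ), 0; 0, 1 / (a ^ 2 + 2)]).map C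
      = !![C (-(1 / 2)), 0; 0, C (-(1 / (a ^ 2 + 2)))] := by
    ext1 i j
    fin_cases i <;> fin_cases j <;> simp
  rw [hm, stepOne, inv_deriv_P_one, deriv_P_one, P_one, P_two]
  simp only [deriv_fin_two, Matrix.mul_fin_two]
  ext1 i j
  refine Polynomial.funext fun t => ?_
  have hb : a ^ 2 + 2 ≠ 0 := by positivity
  have hd : 1 + a ^ 2 ≠ 0 := by positivity
  fin_cases i <;> fin_cases j <;>
    simp [F₂, -map_pow, -map_add, -map_mul] <;> field_simp <;> ring

/-- By `deriv_stepOne`, the derivative of the first step ends with the factor `stepOneCoeff`, while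
`A_{2,1}` begins with its inverse. The two cancel, and only polynomial coefficients survive. -/
theorem stepTwo_stepOne (a : ℝ) (y : MatPoly 2) : stepTwo a (stepOne a y) = toRat (Rop a y) := by
  have hE : toRat (!![C (1 / 8), 0; 0, C (1 / (8 * (1 + a ^ 2)))] : MatPoly 2)
      * toRat (deriv (deriv (P a 2))) = 1 := by
    have hd : 1 + a ^ 2 ≠ 0 := by positivity
    rw [← toRat_mul, ← toRat_one, deriv_deriv_P_two]
    congr 1
    ext1 i j
    refine Polynomial.funext fun t => ?_
    fin_cases i <;> fin_cases j <;> simp [Matrix.mul_apply, Fin.sum_univ_two]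
    field_simp
  have hC : IsUnit (toRat (stepOneCoeff a)).det := by
    have h := isUnit_det_deriv_P₁_two a
    rw [P₁, deriv_stepOne, toRat_mul, Matrix.det_mul] at h
    exact isUnit_of_mul_isUnit_right h
  have h1 : (toRat (deriv (P₁ a 2)))⁻¹ = (toRat (stepOneCoeff a))⁻¹
      * toRat (!![C (1 / 8), 0; 0, C (1 / (8 * (1 + a ^ 2)))] : MatPoly 2) := by
    rw [P₁, deriv_stepOne, toRat_mul, Matrix.mul_inv_rev, Matrix.inv_eq_left_inv hE]
  have h2 : -(toRat (!![C (1 / 8), 0; 0, C (1 / (8 * (1 + a ^ 2)))] : MatPoly 2)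
      * toRat (P₁ a 2) * A₂₀ a) = toRat (F₂ a) := by
    rw [← seed_identity, toRat_neg, toRat_mul, toRat_mul, toRat_map_C]
    rfl
  have h3 : stepOne a y * (-!![(1 / 2 : ℝ), 0; 0, 1 / (a ^ 2 + 2)]).map C
      = y + deriv y * F₁ a := by
    have hb : a ^ 2 + 2 ≠ 0 := by positivity
    have e1 : deriv (P a 1) * (-!![(1 / 2 : ℝ), 0; 0, 1 / (a ^ 2 + 2)]).map C = -1 := by
      rw [deriv_P_one]
      ext1 i j
      refine Polynomial.funext fun t => ?_
      fin_cases i <;> fin_cases j <;> simp [Matrix.mul_apply, Fin.sum_univ_two]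
      field_simp
    have e2 : (deriv (P a 1))⁻¹ * P a 1 = -F₁ a := by
      rw [inv_deriv_P_one, P_one]
      ext1 i j
      refine Polynomial.funext fun t => ?_
      fin_cases i <;> fin_cases j <;> simp [F₁, Matrix.mul_apply, Fin.sum_univ_two] <;> field_simp
    rw [stepOne, add_mul, neg_mul, mul_assoc, mul_assoc (deriv y), mul_assoc (_ * _ : MatPoly 2),
      e1, e2]
    noncomm_ring
  rw [stepTwo, Rop, ← h3, toRat_add, toRat_mul _ (F₂ a), ← h2, deriv_stepOne, h1, toRat_mul,
    toRat_mul, toRat_map_C]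
  congr 1
  simp only [mul_neg, ← mul_assoc]
  rw [mul_assoc (toRat (deriv (deriv y))), Matrix.mul_nonsing_inv _ hC, mul_one]

/-- The polynomial form of the exceptional family. -/
def Q (a : ℝ) (n : ℕ) : MatPoly 2 := Rop a (P a n)

theorem toRat_Q (a : ℝ) (n : ℕ) : toRat (Q a n) = P₂ a n :=
  (stepTwo_stepOne a (P a n)).symm

theorem Q_zero (a : ℝ) : Q a 0 = 1 := by
  have h : P a 0 = 1 := by simp [P, H]
  have h1 : deriv (1 : MatPoly 2) = 0 := by
    rw [Matrix.one_fin_two, deriv_fin_two]; simp [← Matrix.ext_iff]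
  simp [Q, Rop, h, h1, deriv_zero]

/-- `F₁` is `-(P₁')⁻¹ P₁` for the linear seed `P a 1`; this is the gap at 1. -/
theorem Q_one (a : ℝ) : Q a 1 = 0 := by
  rw [Q, Rop, P_one]
  have hb : a ^ 2 + 2 ≠ 0 := by positivity
  ext1 i j
  refine Polynomial.funext fun t => ?_
  fin_cases i <;> fin_cases j <;>
    simp [deriv, F₁, F₂, Matrix.mul_apply, Fin.sum_univ_two, -map_pow, -map_add, -map_mul] <;>
    field_simp <;> ring

/-- The second step annihilates its own seed, the image of `P a 2` under the first step; this is the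
gap at 2. -/
theorem Q_two (a : ℝ) : Q a 2 = 0 := by
  rw [Q, Rop, P_two]
  have hb : a ^ 2 + 2 ≠ 0 := by positivity
  ext1 i j
  refine Polynomial.funext fun t => ?_
  fin_cases i <;> fin_cases j <;>
    simp [deriv, F₁, F₂, Matrix.mul_apply, Fin.sum_univ_two, -map_pow, -map_add, -map_mul] <;>
    field_simp <;> ring

/-! ### The Hermite polynomials and the family `P` -/

theorem derivative_H_succ (n : ℕ) : derivative (H (n + 1)) = 2 * ((n : ℝ[X]) + 1) * H n := by
  induction n with
  | zero => simp [H]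
  | succ n ih =>
    have h1 : H (n + 2) = 2 * X * H (n + 1) - derivative (H (n + 1)) := rfl
    have h2 : H (n + 1) = 2 * X * H n - derivative (H n) := rfl
    have h3 : derivative (derivative (H (n + 1))) = 2 * ((n : ℝ[X]) + 1) * derivative (H n) := by
      rw [ih]; simp
    rw [h1, derivative_sub, h3]
    simp only [derivative_mul, derivative_X, derivative_ofNat, ih]
    push_cast
    linear_combination -(2 * ((n : ℝ[X]) + 1)) * h2

/-- `n H_{n-1}`. -/
def K (n : ℕ) : ℝ[X] := (n : ℝ[X]) * H (n - 1)

/-- The factor `n` in `K n` neutralises the truncated index `n - 1` at `n = 0`, so the rules for `H`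
and `K` hold for every `n`, and identities about `P a n` need no case distinction. -/
theorem derivative_H (n : ℕ) : derivative (H n) = 2 * K n := by
  cases n with
  | zero => simp [H, K]
  | succ n => rw [derivative_H_succ, K]; push_cast; rw [mul_assoc]

theorem derivative_K (n : ℕ) : derivative (K n) = 2 * X * K n - (n : ℝ[X]) * H n := by
  cases n with
  | zero => simp [H, K]
  | succ n =>
    have h2 : H (n + 1) = 2 * X * H n - derivative (H n) := rfl
    simp only [K, derivative_mul, derivative_natCast, Nat.add_sub_cancel, h2]
    ring

theorem H_succ (n : ℕ) : H (n + 1) = 2 * X * H n - 2 * K n := by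
  rw [← derivative_H]; rfl

theorem P_eq (a : ℝ) (n : ℕ) :
    P a n = !![H n, -(C a * K n); -(C a * K n), H n + C (a ^ 2) * X * K n] := by
  ext1 i j
  fin_cases i <;> fin_cases j <;> simp [P, K, -map_pow] <;> ring

/-- The coefficient of `y'` in the differential operator of the family `P`. -/
def L₁ (a : ℝ) : MatPoly 2 := !![-2 * X, C (2 * a); 0, -2 * X]

/-- The coefficient of `y` in the differential operators of the two families. -/
def L₀ : Matrix (Fin 2) (Fin 2) ℝ := !![0, 0; 0, 2]

/-- The eigenvalues of the differential operators of the two families. -/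
def eigenvalue (n : ℕ) : Matrix (Fin 2) (Fin 2) ℝ := !![-2 * (n : ℝ), 0; 0, -2 * ((n : ℝ) - 1)]

theorem map_C_L₀ : L₀.map C = (!![0, 0; 0, C 2] : MatPoly 2) := by
  ext1 i j
  fin_cases i <;> fin_cases j <;> simp [L₀]

theorem P_eigen (a : ℝ) (n : ℕ) :
    deriv (deriv (P a n)) + deriv (P a n) * L₁ a + P a n * L₀.map C
      = (eigenvalue n).map C * P a n := by
  have h1 : (eigenvalue n).map C
      = (!![C (-2 * (n : ℝ)), 0; 0, C (-2 * ((n : ℝ) - 1))] : MatPoly 2) := by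
    ext1 i j
    fin_cases i <;> fin_cases j <;> simp [eigenvalue]
  rw [map_C_L₀, h1, P_eq, L₁]
  simp only [deriv_fin_two, Matrix.mul_fin_two]
  ext1 i j
  refine Polynomial.funext fun t => ?_
  fin_cases i <;> fin_cases j <;>
    simp [derivative_H, derivative_K, -map_pow, -map_add, -map_mul] <;> ring

/-- The numerator of the coefficient of `y'` in the differential operator of the family `Q`. -/
def G₁ (a : ℝ) : MatPoly 2 := F₁ a + F₁ a + L₁ a * F₂ a

/-! ### Intertwining relation and the differential equation of the exceptional family. -/

theorem F₁_mul_L₀ (a : ℝ) :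
    F₁ a * L₀.map C = L₁ a - (F₁ a + F₁ a) + L₀.map C * F₁ a := by
  have hb : a ^ 2 + 2 ≠ 0 := by positivity
  rw [map_C_L₀, L₁, F₁]
  ext1 i j
  refine Polynomial.funext fun t => ?_
  fin_cases i <;> fin_cases j <;>
    simp [Matrix.mul_apply, Fin.sum_univ_two, -map_pow, -map_add, -map_mul] <;> field_simp <;> ring

theorem F₂_mul_L₀ (a : ℝ) :
    F₂ a * L₀.map C
      = 1 + L₁ a * F₁ a - (F₂ a + F₂ a + F₂ a + F₂ a) + L₀.map C * F₂ a := by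
  have hb : a ^ 2 + 2 ≠ 0 := by positivity
  rw [map_C_L₀, L₁, F₁, F₂]
  ext1 i j
  refine Polynomial.funext fun t => ?_
  fin_cases i <;> fin_cases j <;>
    simp [Matrix.mul_apply, Fin.sum_univ_two, -map_pow, -map_add, -map_mul] <;> field_simp <;> ring

theorem deriv_L₁ (a : ℝ) : deriv (L₁ a) = -2 := by
  ext1 i j
  fin_cases i <;> fin_cases j <;> simp [deriv, L₁, Matrix.ofNat_apply, -map_mul]

/-- Comparison of coefficients: `F₁_mul_L₀` is the condition at `y'`, `F₂_mul_L₀` the one at `y''`,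
and `G₁` is chosen so that the coefficients of `y'''` agree. -/
theorem Rop_intertwine (a : ℝ) (y : MatPoly 2) :
    deriv (deriv (Rop a y)) + deriv (deriv (deriv y)) * G₁ a + Rop a y * L₀.map C
      = Rop a (deriv (deriv y) + deriv y * L₁ a + y * L₀.map C) := by
  have hR : Rop a y * L₀.map C = y * L₀.map C + deriv y * (F₁ a * L₀.map C)
      + deriv (deriv y) * (F₂ a * L₀.map C) := by
    rw [Rop]; noncomm_ring
  rw [hR, deriv_Rop, deriv_mul, deriv_F₂, G₁, F₁_mul_L₀, F₂_mul_L₀, Rop]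
  simp only [deriv_add, deriv_mul, deriv_L₁, deriv_map_C, deriv_neg]
  have h2 : deriv (2 : MatPoly 2) = 0 := by
    ext1 i j
    fin_cases i <;> fin_cases j <;> simp [deriv, Matrix.ofNat_apply]
  rw [h2, deriv_zero]
  noncomm_ring

theorem det_F₂ (a : ℝ) : C (16 * (a ^ 2 + 2)) * (F₂ a).det
    = C (4 * (a ^ 2 + 2)) * X ^ 4 + C 8 * X ^ 2 + C (3 * a ^ 2 + 2) := by
  have hb : a ^ 2 + 2 ≠ 0 := by positivity
  refine Polynomial.funext fun t => ?_
  rw [F₂, Matrix.det_fin_two_of]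
  simp [-map_pow, -map_add, -map_mul]
  field_simp
  ring

theorem eval_det_F₂ (a t : ℝ) : (16 * (a ^ 2 + 2)) * (F₂ a).det.eval t = pp a t := by
  have := congrArg (eval t) (det_F₂ a)
  rw [eval_mul, eval_C] at this
  rw [this, pp]
  simp [-map_pow, -map_add, -map_mul]
  ring

/-- A lower bound by 1, not just positivity, allows the denominators to be dropped in every Gaussian
estimate. -/
theorem one_le_pp (a t : ℝ) : 1 ≤ pp a t := by
  have : 0 ≤ 4 * (a ^ 2 + 2) * t ^ 4 + 8 * t ^ 2 + 3 * a ^ 2 := by positivity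
  rw [pp]; linarith

theorem pp_pos (a t : ℝ) : 0 < pp a t := one_pos.trans_le (one_le_pp a t)

theorem isUnit_det_toRat_F₂ (a : ℝ) : IsUnit (toRat (F₂ a)).det := by
  have h : (F₂ a).det ≠ 0 := fun h => by
    have := eval_det_F₂ a 0
    rw [h, eval_zero, mul_zero] at this
    exact (pp_pos a 0).ne this
  rw [isUnit_iff_ne_zero]
  have : (toRat (F₂ a)).det = algebraMap ℝ[X] (RatFunc ℝ) (F₂ a).det :=
    (RingHom.map_det _ _).symm
  rw [this]
  exact fun h0 => h ((map_eq_zero_iff _ (IsFractionRing.injective ℝ[X] (RatFunc ℝ))).1 h0)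

/-- By `deriv_Rop`, `y''' = Q' F₂⁻¹`; this turns the third order term of `Rop_intertwine` into a
first order term in `Q` with rational coefficient. -/
theorem Q_eigen (a : ℝ) (n : ℕ) :
    toRat (deriv (deriv (Q a n))) * 1
        + toRat (deriv (Q a n)) * ((toRat (F₂ a))⁻¹ * toRat (G₁ a)) + toRat (Q a n) * constRat L₀
      = constRat (eigenvalue n) * toRat (Q a n) := by
  have h := congrArg toRat (Rop_intertwine a (P a n))
  rw [P_eigen, Rop_map_C_mul] at h
  simp only [toRat_add, toRat_mul, toRat_map_C] at h
  rw [Q, ← h, mul_one, deriv_Rop, toRat_mul, ← mul_assoc, mul_assoc (toRat (deriv (deriv _))),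
    Matrix.mul_nonsing_inv _ (isUnit_det_toRat_F₂ a), mul_one]

/-! ### Leading coefficients -/

/-- `p` has degree at most `n` and its coefficient of `t ^ n` is `c`. -/
def IsLead (p : ℝ[X]) (n : ℕ) (c : ℝ) : Prop := p.natDegree ≤ n ∧ p.coeff n = c

namespace IsLead

variable {p q : ℝ[X]} {m n : ℕ} {c d : ℝ}

theorem add (hp : IsLead p n c) (hq : IsLead q n d) : IsLead (p + q) n (c + d) :=
  ⟨natDegree_add_le_of_degree_le hp.1 hq.1, by rw [coeff_add, hp.2, hq.2]⟩

theorem mul (hp : IsLead p m c) (hq : IsLead q n d) : IsLead (p * q) (m + n) (c * d) :=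
  ⟨natDegree_mul_le_of_le hp.1 hq.1, by rw [coeff_mul_add_eq_of_natDegree_le hp.1 hq.1, hp.2, hq.2]⟩

theorem derivative (hp : IsLead p (n + 1) c) :
    IsLead (Polynomial.derivative p) n (((n : ℝ) + 1) * c) :=
  ⟨(natDegree_derivative_le p).trans (by have := hp.1; omega), by
    rw [coeff_derivative, hp.2, mul_comm]⟩

theorem of_lt (hp : IsLead p m c) (h : m < n) : IsLead p n 0 :=
  ⟨hp.1.trans h.le, coeff_eq_zero_of_natDegree_lt (hp.1.trans_lt h)⟩

theorem const (c : ℝ) : IsLead (C c) 0 c := ⟨(natDegree_C c).le, coeff_C_zero⟩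

theorem X : IsLead (X : ℝ[X]) 1 1 := ⟨natDegree_X_le, coeff_X_one⟩

theorem const_mul (hp : IsLead p n c) (d : ℝ) : IsLead (C d * p) n (d * c) := by
  simpa using (const d).mul hp

theorem neg (hp : IsLead p n c) : IsLead (-p) n (-c) := by
  simpa using hp.const_mul (-1)

theorem sum {ι : Type*} {s : Finset ι} {f : ι → ℝ[X]} {c : ι → ℝ}
    (h : ∀ i ∈ s, IsLead (f i) n (c i)) : IsLead (∑ i ∈ s, f i) n (∑ i ∈ s, c i) :=
  ⟨natDegree_sum_le_of_forall_le s f fun i hi => (h i hi).1, by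
    rw [finsetSum_coeff]; exact Finset.sum_congr rfl fun i hi => (h i hi).2⟩

end IsLead

theorem isLead_H (n : ℕ) : IsLead (H n) n (2 ^ n) := by
  -- The second component says that `H n'`, subtracted in the recurrence, does not contribute to
  -- degree `n + 1`.
  have key : ∀ n, IsLead (H n) n (2 ^ n) ∧ IsLead (derivative (H n)) (n + 1) 0 := by
    intro n
    have aux : ∀ {n}, IsLead (H n) n (2 ^ n) → IsLead (derivative (H n)) (n + 1) 0 := by
      intro n h
      have h1 := (h.of_lt (Nat.lt_succ_self n)).derivative
      exact h1.of_lt (Nat.lt_succ_self n)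
    induction n with
    | zero => exact ⟨by simpa [H] using IsLead.const 1, aux (by simpa [H] using IsLead.const 1)⟩
    | succ n ih =>
      have h : IsLead (H (n + 1)) (n + 1) (2 ^ (n + 1)) := by
        have h0 := (IsLead.X.mul ih.1).const_mul 2
        rw [add_comm 1 n] at h0
        have h1 := h0.add ih.2.neg
        have e : H (n + 1) = C 2 * (X * H n) + -derivative (H n) := by
          rw [H, C_ofNat]; ring
        rw [e, pow_succ']
        convert! h1 using 1; ring
      exact ⟨h, aux h⟩
  exact (key n).1

/-- `P` has degree at most `n` and its matrix coefficient of `t ^ n` is `A`. -/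
def IsMatLead {N : ℕ} (P : MatPoly N) (n : ℕ) (A : Matrix (Fin N) (Fin N) ℝ) : Prop :=
  ∀ i j, IsLead (P i j) n (A i j)

namespace IsMatLead

variable {N m n : ℕ} {P Q : MatPoly N} {A B : Matrix (Fin N) (Fin N) ℝ}

theorem add (hP : IsMatLead P n A) (hQ : IsMatLead Q n B) : IsMatLead (P + Q) n (A + B) :=
  fun i j => (hP i j).add (hQ i j)

theorem mul (hP : IsMatLead P m A) (hQ : IsMatLead Q n B) : IsMatLead (P * Q) (m + n) (A * B) :=
  fun i j => by
    rw [Matrix.mul_apply, Matrix.mul_apply]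
    exact IsLead.sum fun k _ => (hP i k).mul (hQ k j)

theorem deriv (hP : IsMatLead P (n + 1) A) :
    IsMatLead (deriv P) n (((n : ℝ) + 1) • A) :=
  fun i j => (hP i j).derivative

theorem hasNonsingularLeading (hP : IsMatLead P n A) (hA : IsUnit A.det) :
    HasNonsingularLeading P n := by
  refine ⟨fun i j => (hP i j).1, ?_⟩
  have : P.map (fun p => p.coeff n) = A := by ext1 i j; exact (hP i j).2
  rwa [this]

end IsMatLead

/-- The leading coefficient of `P a n`. -/
def leadP (a : ℝ) (n : ℕ) : Matrix (Fin 2) (Fin 2) ℝ :=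
  !![2 ^ n, 0; 0, 2 ^ n * (1 + a ^ 2 * n / 2)]

theorem isMatLead_P (a : ℝ) (n : ℕ) : IsMatLead (P a n) n (leadP a n) := by
  cases n with
  | zero =>
    have : P a 0 = 1 := by simp [P, H]
    intro i j
    rw [this]
    fin_cases i <;> fin_cases j <;> simp [leadP, IsLead]
  | succ n =>
    have hK : K (n + 1) = C ((n : ℝ) + 1) * H n := by simp [K]
    have h1 := isLead_H (n + 1)
    have h2 : IsLead (-(C a * K (n + 1))) (n + 1) 0 := by
      rw [hK]
      exact (((isLead_H n).const_mul _).const_mul a).neg.of_lt (Nat.lt_succ_self n)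
    have h3 : IsLead (H (n + 1) + C (a ^ 2) * X * K (n + 1)) (n + 1)
        (2 ^ (n + 1) * (1 + a ^ 2 * ((n + 1 : ℕ) : ℝ) / 2)) := by
      have h := (((isLead_H n).const_mul ((n : ℝ) + 1)).const_mul (a ^ 2))
      rw [← hK] at h
      have h4 := IsLead.X.mul h
      rw [add_comm 1 n] at h4
      convert! h1.add h4 using 1
      · ring
      · push_cast; ring
    intro i j
    rw [P_eq]
    fin_cases i <;> fin_cases j
    exacts [h1, h2, h2, h3]

theorem isUnit_det_leadP (a : ℝ) (n : ℕ) : IsUnit (leadP a n).det := by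
  rw [leadP, Matrix.det_fin_two_of, isUnit_iff_ne_zero]
  have : 0 < 2 ^ n * (2 ^ n * (1 + a ^ 2 * n / 2)) - 0 * 0 := by
    rw [mul_zero, sub_zero]; positivity
  exact this.ne'

theorem isMatLead_F₁ (a : ℝ) : IsMatLead (F₁ a) 1 (-1) := by
  intro i j
  fin_cases i <;> fin_cases j
  · simpa [F₁] using IsLead.X.neg
  · simpa [F₁, -map_div₀] using (IsLead.const (a / 2)).of_lt one_pos
  · simpa [F₁, -map_div₀] using (IsLead.const (a / (a ^ 2 + 2))).of_lt one_pos
  · simpa [F₁] using IsLead.X.neg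

theorem isMatLead_F₂ (a : ℝ) : IsMatLead (F₂ a) 2 ((1 / 2 : ℝ) • 1) := by
  have hX : IsLead ((X : ℝ[X]) ^ 2) 2 1 := by
    rw [pow_two]; simpa using IsLead.X.mul IsLead.X
  intro i j
  fin_cases i <;> fin_cases j
  · simpa [F₂, -map_div₀, -map_mul, -map_add] using (hX.const_mul (1 / 2)).add
      ((IsLead.const ((3 * a ^ 2 + 2) / (4 * (a ^ 2 + 2)))).of_lt two_pos)
  · simpa [F₂] using ((IsLead.X.const_mul (a / 2)).of_lt one_lt_two).neg
  · simpa [F₂] using ((IsLead.X.const_mul (a / (a ^ 2 + 2))).of_lt one_lt_two).neg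
  · simpa [F₂] using (hX.const_mul (1 / 2)).add ((IsLead.const (1 / 4)).of_lt two_pos)

theorem isMatLead_Q (a : ℝ) (n : ℕ) :
    IsMatLead (Q a (n + 2)) (n + 2) (((n : ℝ) * ((n : ℝ) + 1) / 2) • leadP a (n + 2)) := by
  have h := isMatLead_P a (n + 2)
  have h1 := (h.deriv).mul (isMatLead_F₁ a)
  have h2 := (h.deriv.deriv).mul (isMatLead_F₂ a)
  -- With `m = n + 2` the scalar is `1 - m + m (m - 1) / 2 = (m - 1)(m - 2) / 2`, nonzero for `m ≥
  -- 3`.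
  have h3 := (h.add h1).add h2
  have : leadP a (n + 2) + ((((n + 1 : ℕ) : ℝ) + 1) • leadP a (n + 2)) * -1
      + (((n : ℝ) + 1) • ((((n + 1 : ℕ) : ℝ) + 1) • leadP a (n + 2))) * ((1 / 2 : ℝ) • 1)
      = ((n : ℝ) * ((n : ℝ) + 1) / 2) • leadP a (n + 2) := by
    rw [mul_neg, mul_one, mul_smul_comm, mul_one]
    push_cast
    module
  rw [← this]
  exact h3

theorem hasNonsingularLeading_Q (a : ℝ) (n : ℕ) (hn : n ∉ ({1, 2} : Finset ℕ)) :
    HasNonsingularLeading (Q a n) n := by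
  rcases n with - | - | - | n
  · rw [Q_zero]
    refine IsMatLead.hasNonsingularLeading (A := 1) ?_ (by simp)
    intro i j
    fin_cases i <;> fin_cases j <;> simp [IsLead]
  · simp at hn
  · simp at hn
  · refine (isMatLead_Q a (n + 1)).hasNonsingularLeading ?_
    rw [Matrix.det_smul]
    refine IsUnit.mul (isUnit_iff_ne_zero.2 ?_) (isUnit_det_leadP a _)
    positivity

/-! ### Functions dominated by a polynomial times a Gaussian -/

/-- `f` is continuous and bounded by a polynomial times `exp (-t ^ 2)`. -/
def GaussDom (f : ℝ → ℝ) : Prop :=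
  Continuous f ∧ ∃ p : ℝ[X], ∀ t, |f t| ≤ p.eval t * Real.exp (-t ^ 2)

theorem integrable_eval_mul_gauss (p : ℝ[X]) :
    Integrable (fun t => p.eval t * Real.exp (-t ^ 2)) := by
  induction p using Polynomial.induction_on' with
  | add p q hp hq =>
    simp only [eval_add, add_mul]
    exact hp.add hq
  | monomial n c =>
    have h := integrable_rpow_mul_exp_neg_mul_sq one_pos (s := n)
      (by linarith [(Nat.cast_nonneg n : (0 : ℝ) ≤ n)])
    simp only [Real.rpow_natCast, neg_mul, one_mul] at h
    simpa only [eval_monomial, mul_assoc] using h.const_mul c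

namespace GaussDom

variable {f g : ℝ → ℝ}

theorem integrable (hf : GaussDom f) : Integrable f := by
  obtain ⟨hc, p, hp⟩ := hf
  exact (integrable_eval_mul_gauss p).mono' hc.aestronglyMeasurable (.of_forall hp)

theorem add (hf : GaussDom f) (hg : GaussDom g) : GaussDom (fun t => f t + g t) := by
  obtain ⟨hc, p, hp⟩ := hf
  obtain ⟨hd, q, hq⟩ := hg
  refine ⟨hc.add hd, p + q, fun t => ?_⟩
  rw [eval_add, add_mul]
  exact (abs_add_le _ _).trans (add_le_add (hp t) (hq t))

theorem eval_mul (hf : GaussDom f) (q : ℝ[X]) : GaussDom (fun t => q.eval t * f t) := by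
  obtain ⟨hc, p, hp⟩ := hf
  -- The bound `|q| ≤ q² + 1` replaces an absolute value by a polynomial.
  refine ⟨q.continuous.mul hc, (q ^ 2 + 1) * p, fun t => ?_⟩
  have h1 : |q.eval t| ≤ q.eval t ^ 2 + 1 := by
    rw [← sq_abs]; nlinarith [sq_nonneg (|q.eval t| - 1), abs_nonneg (q.eval t)]
  rw [abs_mul, Polynomial.eval_mul, mul_assoc]
  simp only [eval_add, eval_pow, eval_one]
  exact mul_le_mul h1 (hp t) (abs_nonneg _) (by positivity)

theorem const_mul (hf : GaussDom f) (c : ℝ) : GaussDom (fun t => c * f t) := by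
  simpa using hf.eval_mul (C c)

theorem neg (hf : GaussDom f) : GaussDom (fun t => -f t) := by
  simpa using hf.const_mul (-1)

theorem sub (hf : GaussDom f) (hg : GaussDom g) : GaussDom (fun t => f t - g t) := by
  simpa only [sub_eq_add_neg] using hf.add hg.neg

theorem gauss : GaussDom (fun t => Real.exp (-t ^ 2)) :=
  ⟨by fun_prop, 1, fun t => by rw [eval_one, one_mul, abs_of_pos (Real.exp_pos _)]⟩

theorem div {d : ℝ → ℝ} (hf : GaussDom f) (hd : Continuous d) (h : ∀ t, 1 ≤ d t) :
    GaussDom (fun t => f t / d t) := by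
  obtain ⟨hc, p, hp⟩ := hf
  refine ⟨hc.div hd fun t => (one_pos.trans_le (h t)).ne', p, fun t => ?_⟩
  rw [abs_div, abs_of_pos (one_pos.trans_le (h t))]
  exact (div_le_self (abs_nonneg _) (h t)).trans (hp t)

theorem sum {ι : Type*} {s : Finset ι} {F : ι → ℝ → ℝ} (h : ∀ i ∈ s, GaussDom (F i)) :
    GaussDom (fun t => ∑ i ∈ s, F i t) := by
  classical
  induction s using Finset.induction_on with
  | empty => exact ⟨by simpa using continuous_const, 0, by simp⟩
  | insert i s hi ih =>
    simp only [Finset.sum_insert hi]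
    exact (h i (Finset.mem_insert_self i s)).add
      (ih fun j hj => h j (Finset.mem_insert_of_mem hj))

end GaussDom

theorem hasDerivAt_gauss (t : ℝ) :
    HasDerivAt (fun s : ℝ => Real.exp (-s ^ 2)) (-(2 * t) * Real.exp (-t ^ 2)) t := by
  have h := ((hasDerivAt_pow 2 t).neg).exp
  simp only [Nat.cast_ofNat, Nat.add_one_sub_one, pow_one] at h
  convert! h using 1
  simp only [Pi.neg_apply]
  ring

/-! ### Orthogonality of the Hermite polynomials -/

/-- The linear functional `p ↦ ∫ p(t) exp (-t ^ 2) dt`. -/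
def gaussInt (p : ℝ[X]) : ℝ := ∫ t, p.eval t * Real.exp (-t ^ 2)

theorem gaussInt_add (p q : ℝ[X]) : gaussInt (p + q) = gaussInt p + gaussInt q := by
  rw [gaussInt, gaussInt, gaussInt,
    ← integral_add (integrable_eval_mul_gauss p) (integrable_eval_mul_gauss q)]
  simp only [eval_add, add_mul]

theorem gaussInt_C_mul (c : ℝ) (p : ℝ[X]) : gaussInt (C c * p) = c * gaussInt p := by
  rw [gaussInt, gaussInt, ← integral_const_mul]
  simp only [eval_mul, eval_C, mul_assoc]

/-- Integration by parts: `(H n q exp(-t²))' = (H n q' - H (n + 1) q) exp(-t²)`. -/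
theorem gaussInt_H_succ_mul (n : ℕ) (q : ℝ[X]) :
    gaussInt (H (n + 1) * q) = gaussInt (H n * derivative q) := by
  have h := integral_eq_zero_of_hasDerivAt_of_integrable
    (f := fun t => (H n * q).eval t * Real.exp (-t ^ 2))
    (f' := fun t => (H n * derivative q + C (-1) * (H (n + 1) * q)).eval t * Real.exp (-t ^ 2))
    (fun t => by
      refine (((H n * q).hasDerivAt t).mul (hasDerivAt_gauss t)).congr_deriv ?_
      rw [H]
      simp
      ring)
    (integrable_eval_mul_gauss _) (integrable_eval_mul_gauss _)
  have h2 : gaussInt (H n * derivative q + C (-1) * (H (n + 1) * q)) = 0 := h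
  rw [gaussInt_add, gaussInt_C_mul] at h2
  linarith

theorem gaussInt_H_mul_H (n k : ℕ) :
    gaussInt (H n * H k) = if n = k then Real.sqrt Real.pi * 2 ^ n * n.factorial else 0 := by
  have h0 : ∀ k, gaussInt (H (k + 1)) = 0 := fun k => by
    have := gaussInt_H_succ_mul k 1
    rw [mul_one, derivative_one, mul_zero] at this
    rw [this]; simp [gaussInt]
  induction n generalizing k with
  | zero =>
    cases k with
    | zero =>
      have := integral_gaussian 1
      simpa [H, gaussInt] using this
    | succ k => simpa [H] using h0 k
  | succ n ih =>
    cases k with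
    | zero => simpa [H] using h0 n
    | succ k =>
      have e : H n * derivative (H (k + 1)) = C (2 * ((k : ℝ) + 1)) * (H n * H k) := by
        rw [derivative_H_succ, C_mul, C_ofNat]; simp; ring
      rw [gaussInt_H_succ_mul, e, gaussInt_C_mul, ih]
      by_cases h : n = k
      · subst h
        simp [Nat.factorial_succ, pow_succ]; ring
      · simp [h]

/-! ### The Gram matrices of the family `P` -/

/-- The triangular factor of `W` turns every entry into a constant multiple of one Hermite
polynomial: the recurrence for `H (n + 1)` absorbs one factor `t`, and the terms `a² t K n` cancel.
-/
theorem evalAt_P_mul (a : ℝ) (n : ℕ) (t : ℝ) :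
    evalAt (P a n) t * !![1, a * t; 0, 1]
      = evalAt !![H n, C (a / 2) * H (n + 1); -(C a * K n), H n] t := by
  rw [P_eq, H_succ]
  ext1 i j
  fin_cases i <;> fin_cases j <;> simp [evalAt, Matrix.mul_apply, Fin.sum_univ_two] <;> ring

/-- As `W = exp(-t²) T Tᵀ`, the matrix form is a sum of scalar Gaussian integrals over the rows of
`A T` and `B T`. -/
theorem gram_W_apply (a : ℝ) (A B : MatPoly 2) (i j : Fin 2) {A' B' : MatPoly 2}
    (hA : ∀ t, evalAt A t * !![1, a * t; 0, 1] = evalAt A' t)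
    (hB : ∀ t, evalAt B t * !![1, a * t; 0, 1] = evalAt B' t) :
    gram (W a) A B i j = gaussInt (A' i 0 * B' j 0) + gaussInt (A' i 1 * B' j 1) := by
  rw [← gaussInt_add, gram, gaussInt, Matrix.of_apply]
  congr 1
  funext t
  have : evalAt A t * W a t * (evalAt B t).transpose
      = Real.exp (-t ^ 2) • (evalAt A' t * (evalAt B' t).transpose) := by
    rw [W, mul_smul_comm, smul_mul_assoc, ← mul_assoc, mul_assoc, ← Matrix.transpose_mul, hA, hB]
  rw [this]
  simp [Matrix.mul_apply, Fin.sum_univ_two, evalAt]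
  ring

theorem gram_P (a : ℝ) (n k : ℕ) :
    gram (W a) (P a n) (P a k) = if n = k then
      (Real.sqrt Real.pi * 2 ^ n * (n.factorial : ℝ)) •
        !![1 + a ^ 2 * ((n : ℝ) + 1) / 2, 0; 0, 1 + a ^ 2 * (n : ℝ) / 2] else 0 := by
  have hK : ∀ n k, gaussInt (K n * H k)
      = n * (if n = k + 1 then Real.sqrt Real.pi * 2 ^ k * k.factorial else 0) := fun n k => by
    cases n with
    | zero => simp [K, gaussInt]
    | succ n =>
      have : K (n + 1) * H k = C (((n + 1 : ℕ) : ℝ)) * (H n * H k) := by simp [K]; ring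
      rw [this, gaussInt_C_mul, gaussInt_H_mul_H]
      by_cases h : n = k
      · subst h; simp
      · simp [h]
  have hKK : ∀ n k, gaussInt (K n * K k)
      = if n = k then n * (Real.sqrt Real.pi * 2 ^ n * n.factorial) / 2 else 0 := fun n k => by
    cases k with
    | zero => by_cases h : n = 0 <;> simp [K, gaussInt, h]
    | succ k =>
      have : K n * K (k + 1) = C (((k + 1 : ℕ) : ℝ)) * (K n * H k) := by simp [K]; ring
      rw [this, gaussInt_C_mul, hK]
      by_cases h : n = k + 1
      · subst h; simp [Nat.factorial_succ, pow_succ]; ring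
      · simp [h]
  ext1 i j
  rw [gram_W_apply a _ _ i j (evalAt_P_mul a n) (evalAt_P_mul a k)]
  fin_cases i <;> fin_cases j
  · have e : C (a / 2) * H (n + 1) * (C (a / 2) * H (k + 1))
        = C (a / 2 * (a / 2)) * (H (n + 1) * H (k + 1)) := by rw [C_mul]; ring
    simp only [Fin.zero_eta, Matrix.of_apply, Matrix.cons_val_zero, Matrix.cons_val_one, e,
      gaussInt_C_mul, gaussInt_H_mul_H]
    by_cases h : n = k
    · subst h; simp [Nat.factorial_succ, pow_succ]; ring
    · simp [h]
  · have e : H n * -(C a * K k) = C (-a) * (K k * H n) := by rw [C_neg]; ring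
    have e' : C (a / 2) * H (n + 1) * H k = C (a / 2) * (H (n + 1) * H k) := by ring
    simp only [Fin.zero_eta, Fin.mk_one, Matrix.of_apply, Matrix.cons_val_zero,
      Matrix.cons_val_one, e, e', gaussInt_C_mul, gaussInt_H_mul_H, hK]
    by_cases h : n + 1 = k
    · subst h; simp [Nat.factorial_succ, pow_succ]; ring
    · have h' : k ≠ n + 1 := fun e => h e.symm
      by_cases h2 : n = k <;> simp [h, h', h2]
  · have e : -(C a * K n) * H k = C (-a) * (K n * H k) := by rw [C_neg]; ring
    have e' : H n * (C (a / 2) * H (k + 1)) = C (a / 2) * (H n * H (k + 1)) := by ring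
    simp only [Fin.zero_eta, Fin.mk_one, Matrix.of_apply, Matrix.cons_val_zero,
      Matrix.cons_val_one, e, e', gaussInt_C_mul, gaussInt_H_mul_H, hK]
    by_cases h : n = k + 1
    · subst h; simp [Nat.factorial_succ, pow_succ]; ring
    · by_cases h2 : n = k <;> simp [h, h2]
  · have e : -(C a * K n) * -(C a * K k) = C (a * a) * (K n * K k) := by rw [C_mul]; ring
    simp only [Fin.mk_one, Matrix.of_apply, Matrix.cons_val_zero, Matrix.cons_val_one, e,
      gaussInt_C_mul, gaussInt_H_mul_H, hKK]
    by_cases h : n = k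
    · subst h; simp; ring
    · simp [h]

/-! ### Entrywise calculus of matrix functions -/

section Calculus

variable {N : ℕ}

/-- The entrywise derivative of a matrix function. -/
def MatHasDerivAt (M : ℝ → Matrix (Fin N) (Fin N) ℝ) (M' : Matrix (Fin N) (Fin N) ℝ) (t : ℝ) :
    Prop :=
  ∀ i j, HasDerivAt (fun s => M s i j) (M' i j) t

/-- All entries are dominated by a polynomial times a Gaussian. -/
def MatGaussDom (M : ℝ → Matrix (Fin N) (Fin N) ℝ) : Prop := ∀ i j, GaussDom (fun t => M t i j)

variable {A B : ℝ → Matrix (Fin N) (Fin N) ℝ} {A' B' : Matrix (Fin N) (Fin N) ℝ} {t : ℝ}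

namespace MatHasDerivAt

theorem add (hA : MatHasDerivAt A A' t) (hB : MatHasDerivAt B B' t) :
    MatHasDerivAt (fun s => A s + B s) (A' + B') t :=
  fun i j => (hA i j).add (hB i j)

theorem sub (hA : MatHasDerivAt A A' t) (hB : MatHasDerivAt B B' t) :
    MatHasDerivAt (fun s => A s - B s) (A' - B') t :=
  fun i j => (hA i j).sub (hB i j)

theorem mul (hA : MatHasDerivAt A A' t) (hB : MatHasDerivAt B B' t) :
    MatHasDerivAt (fun s => A s * B s) (A' * B t + A t * B') t := fun i j => by
  simp only [Matrix.mul_apply, Matrix.add_apply, ← Finset.sum_add_distrib]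
  exact HasDerivAt.fun_sum fun k _ => (hA i k).mul (hB k j)

theorem transpose (hA : MatHasDerivAt A A' t) :
    MatHasDerivAt (fun s => (A s).transpose) A'.transpose t :=
  fun i j => hA j i

theorem evalAt (y : MatPoly N) (t : ℝ) :
    MatHasDerivAt (evalAt y) (ExcMatrix.evalAt (deriv y) t) t :=
  fun i j => (y i j).hasDerivAt t

end MatHasDerivAt

namespace MatGaussDom

theorem add (hA : MatGaussDom A) (hB : MatGaussDom B) : MatGaussDom (fun t => A t + B t) :=
  fun i j => (hA i j).add (hB i j)

theorem sub (hA : MatGaussDom A) (hB : MatGaussDom B) : MatGaussDom (fun t => A t - B t) :=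
  fun i j => (hA i j).sub (hB i j)

theorem evalAt_mul (hA : MatGaussDom A) (y : MatPoly N) :
    MatGaussDom (fun t => evalAt y t * A t) := fun i j => by
  simp only [Matrix.mul_apply]
  exact GaussDom.sum fun k _ => (hA k j).eval_mul (y i k)

theorem transpose (hA : MatGaussDom A) : MatGaussDom (fun t => (A t).transpose) :=
  fun i j => hA j i

theorem mul_evalAt_transpose (hA : MatGaussDom A) (y : MatPoly N) :
    MatGaussDom (fun t => A t * (evalAt y t).transpose) := by
  simpa only [Matrix.transpose_mul, Matrix.transpose_transpose] using
    (hA.transpose.evalAt_mul y).transpose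

theorem gauss_smul (y : MatPoly N) : MatGaussDom (fun t => Real.exp (-t ^ 2) • evalAt y t) :=
  fun i j => by
    have := GaussDom.gauss.eval_mul (y i j)
    simpa only [Matrix.smul_apply, smul_eq_mul, mul_comm, evalAt, Matrix.map_apply] using this

end MatGaussDom

end Calculus

/-! ### The exceptional weight -/

/-- The numerator of `F₂ 𝒲`. -/
def FWnum (a : ℝ) : MatPoly 2 :=
  !![C (3 * a ^ 2 + 2) + C (3 * a ^ 4 + 12 * a ^ 2 + 4) * X ^ 2
        + C (2 * a ^ 2 * (a ^ 2 + 2)) * X ^ 4,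
      C (a * (3 * a ^ 2 + 2) * (a ^ 2 + 6) / (a ^ 2 + 2)) * X + C (2 * a * (3 * a ^ 2 + 2)) * X ^ 3;
    C (3 * a * (a ^ 2 + 2)) * X + C (2 * a * (a ^ 2 + 2)) * X ^ 3,
      C (3 * a ^ 2 + 2) + C (2 * (3 * a ^ 2 + 2)) * X ^ 2]

/-- The numerator of `(F₂ 𝒲)' - F₁ 𝒲`. -/
def Znum (a : ℝ) : MatPoly 2 :=
  !![C (2 * a ^ 2 - 4) * X - C (2 * a ^ 4 + 16 * a ^ 2 + 8) * X ^ 3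
        - C (4 * a ^ 2 * (a ^ 2 + 2)) * X ^ 5,
      C (a * (3 * a ^ 2 + 2) * (2 - a ^ 2) / (a ^ 2 + 2))
        - C (8 * a * (3 * a ^ 2 + 2) / (a ^ 2 + 2)) * X ^ 2 - C (4 * a * (3 * a ^ 2 + 2)) * X ^ 4;
    C (a * (3 * a ^ 2 + 2)) - C (8 * a) * X ^ 2 - C (4 * a * (a ^ 2 + 2)) * X ^ 4,
      C ((3 * a ^ 2 + 2) * (2 * a ^ 2 - 4) / (a ^ 2 + 2)) * X - C (4 * (3 * a ^ 2 + 2)) * X ^ 3]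

/-- The polynomial part of `F₂ 𝒲 F₂ᵀ`. -/
def Enum (a : ℝ) : MatPoly 2 :=
  !![C ((3 * a ^ 2 + 2) / (a ^ 2 + 2)) + C (a ^ 2) * X ^ 2, C a * X; C a * X, 1]

/-- The product `F₂ 𝒲`. -/
def FW (a t : ℝ) : Matrix (Fin 2) (Fin 2) ℝ :=
  (Real.exp (-t ^ 2) / (4 * (3 * a ^ 2 + 2) ^ 2 * pp a t)) • evalAt (FWnum a) t

/-- The function `(F₂ 𝒲)' - F₁ 𝒲`. -/
def Z (a t : ℝ) : Matrix (Fin 2) (Fin 2) ℝ :=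
  (Real.exp (-t ^ 2) / (4 * (3 * a ^ 2 + 2) ^ 2 * pp a t)) • evalAt (Znum a) t

/-- The product `F₂ 𝒲 F₂ᵀ`. -/
def E (a t : ℝ) : Matrix (Fin 2) (Fin 2) ℝ :=
  (Real.exp (-t ^ 2) / (16 * (3 * a ^ 2 + 2) ^ 2)) • evalAt (Enum a) t

/-- The derivative of `E`. -/
def E' (a t : ℝ) : Matrix (Fin 2) (Fin 2) ℝ :=
  (Real.exp (-t ^ 2) / (16 * (3 * a ^ 2 + 2) ^ 2)) •
    (evalAt (deriv (Enum a)) t - (2 * t) • evalAt (Enum a) t)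

/-- The antisymmetric part of `Z F₂ᵀ`. -/
def skewPart (a t : ℝ) : Matrix (Fin 2) (Fin 2) ℝ :=
  (Real.exp (-t ^ 2) / (16 * (3 * a ^ 2 + 2) ^ 2)) •
    !![0, -2 * a ^ 3 / (a ^ 2 + 2); 2 * a ^ 3 / (a ^ 2 + 2), 0]

/-- The sum `Z' + 𝒲`. -/
def C₀ (a t : ℝ) : Matrix (Fin 2) (Fin 2) ℝ :=
  W a t * !![1 / (2 * (3 * a ^ 2 + 2) ^ 2), 0; 0, 1 / (2 * (3 * a ^ 2 + 2) * (a ^ 2 + 2))]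

theorem transpose_fin_two (p q r s : ℝ) : (!![p, q; r, s]).transpose = !![p, r; q, s] := by
  ext1 i j
  fin_cases i <;> fin_cases j <;> rfl

theorem W_eq (a t : ℝ) : W a t = !![Real.exp (-t ^ 2) * (1 + a ^ 2 * t ^ 2),
    Real.exp (-t ^ 2) * (a * t); Real.exp (-t ^ 2) * (a * t), Real.exp (-t ^ 2)] := by
  rw [W, transpose_fin_two, Matrix.mul_fin_two]
  ext1 i j
  fin_cases i <;> fin_cases j <;> simp
  ring

theorem F₂_mul_excW (a t : ℝ) : evalAt (F₂ a) t * excW a t = FW a t := by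
  have hb : a ^ 2 + 2 ≠ 0 := by positivity
  have hc : 3 * a ^ 2 + 2 ≠ 0 := by positivity
  have hp := (pp_pos a t).ne'
  rw [FW, excW]
  generalize Real.exp (-t ^ 2) = w
  ext1 i j
  fin_cases i <;> fin_cases j <;>
    simp [evalAt, F₂, FWnum, Matrix.mul_apply, Fin.sum_univ_two] <;> field_simp <;>
    simp only [pp] <;> ring

/-- Here the denominator `𝔭` disappears: `𝒲` is `F₂⁻¹ E F₂⁻ᵀ`, with `E` a Gaussian times a
polynomial matrix. -/
theorem FW_mul_F₂_transpose (a t : ℝ) : FW a t * (evalAt (F₂ a) t).transpose = E a t := by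
  have hb : a ^ 2 + 2 ≠ 0 := by positivity
  have hc : 3 * a ^ 2 + 2 ≠ 0 := by positivity
  have hp := (pp_pos a t).ne'
  rw [FW, E]
  generalize Real.exp (-t ^ 2) = w
  ext1 i j
  fin_cases i <;> fin_cases j <;>
    simp [evalAt, F₂, FWnum, Enum, Matrix.mul_apply, Fin.sum_univ_two] <;> field_simp <;>
    simp only [pp] <;> ring

/-- Again no `𝔭` is left, and the product fails to be symmetric only by a constant skew matrix times
the Gaussian. -/
theorem Z_mul_F₂_transpose (a t : ℝ) :
    Z a t * (evalAt (F₂ a) t).transpose = E' a t + skewPart a t := by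
  have hb : a ^ 2 + 2 ≠ 0 := by positivity
  have hc : 3 * a ^ 2 + 2 ≠ 0 := by positivity
  have hp := (pp_pos a t).ne'
  rw [Z, E', skewPart]
  generalize Real.exp (-t ^ 2) = w
  ext1 i j
  fin_cases i <;> fin_cases j <;>
    simp [evalAt, deriv, F₂, Znum, Enum, Matrix.mul_apply, Fin.sum_univ_two, -map_pow] <;>
    field_simp <;> simp only [pp] <;> ring

theorem hasDerivAt_pp (a t : ℝ) :
    HasDerivAt (pp a) (16 * (a ^ 2 + 2) * t ^ 3 + 16 * t) t := by
  have h := ((((hasDerivAt_pow 4 t).const_mul (4 * (a ^ 2 + 2))).add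
    ((hasDerivAt_pow 2 t).const_mul 8)).add_const (3 * a ^ 2)).add_const 2
  convert! h using 1
  push_cast
  ring

theorem hasDerivAt_gauss_div_pp (a k t : ℝ) (hk : k ≠ 0) (q : ℝ[X]) :
    HasDerivAt (fun s => Real.exp (-s ^ 2) / (k * pp a s) * q.eval s)
      (Real.exp (-t ^ 2) / (k * pp a t ^ 2) * (((derivative q).eval t - 2 * t * q.eval t) * pp a t
        - q.eval t * (16 * (a ^ 2 + 2) * t ^ 3 + 16 * t))) t := by
  have hp := (pp_pos a t).ne'
  have h := ((hasDerivAt_gauss t).fun_div ((hasDerivAt_pp a t).const_mul k)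
    (mul_ne_zero hk hp)).fun_mul (q.hasDerivAt t)
  refine h.congr_deriv ?_
  field_simp
  ring

theorem matHasDerivAt_FW (a t : ℝ) :
    MatHasDerivAt (FW a) (Z a t + evalAt (F₁ a) t * excW a t) t := by
  have hb : a ^ 2 + 2 ≠ 0 := by positivity
  have hc : 3 * a ^ 2 + 2 ≠ 0 := by positivity
  have hp := (pp_pos a t).ne'
  have hk : 4 * (3 * a ^ 2 + 2) ^ 2 ≠ 0 := by positivity
  intro i j
  refine (hasDerivAt_gauss_div_pp a _ t hk (FWnum a i j)).congr_deriv ?_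
  rw [Z, excW]
  generalize Real.exp (-t ^ 2) = w
  fin_cases i <;> fin_cases j <;>
    simp [evalAt, F₁, FWnum, Znum, Matrix.mul_apply, Fin.sum_univ_two, -map_pow, -map_add,
      -map_mul, -map_sub, -map_div₀] <;>
    field_simp <;> simp only [pp] <;> ring

/-- This ties the two weights together: up to the derivative of `Z`, the exceptional weight is `W a`
times a constant diagonal matrix. -/
theorem matHasDerivAt_Z (a t : ℝ) : MatHasDerivAt (Z a) (C₀ a t - excW a t) t := by
  have hb : a ^ 2 + 2 ≠ 0 := by positivity
  have hc : 3 * a ^ 2 + 2 ≠ 0 := by positivity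
  have hp := (pp_pos a t).ne'
  have hk : 4 * (3 * a ^ 2 + 2) ^ 2 ≠ 0 := by positivity
  intro i j
  refine (hasDerivAt_gauss_div_pp a _ t hk (Znum a i j)).congr_deriv ?_
  rw [C₀, W_eq, excW]
  generalize Real.exp (-t ^ 2) = w
  fin_cases i <;> fin_cases j <;>
    simp [Znum, -map_pow, -map_add,
      -map_mul, -map_sub, -map_div₀] <;>
    field_simp <;> simp only [pp] <;> ring

theorem matHasDerivAt_E (a t : ℝ) : MatHasDerivAt (E a) (E' a t) t := by
  intro i j
  have h := ((hasDerivAt_gauss t).div_const (16 * (3 * a ^ 2 + 2) ^ 2)).fun_mul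
    ((Enum a i j).hasDerivAt t)
  refine h.congr_deriv ?_
  simp only [E', evalAt, deriv, Matrix.smul_apply, Matrix.sub_apply, Matrix.map_apply, smul_eq_mul]
  ring

/-! ### Integration by parts against the exceptional weight. -/

/-- The differentiated function is the boundary term of two integrations by parts that free `y` of
derivatives. Each derivative falling on `Rop a z` yields `F₂ᵀ (z''')ᵀ`, and this `F₂ᵀ` clears the
denominators of `FW` and `Z`. -/
theorem integrand_eq (a : ℝ) (y z : MatPoly 2) (t : ℝ) :
    MatHasDerivAt (fun t => evalAt (deriv y) t * FW a t * (evalAt (Rop a z) t).transpose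
        - evalAt y t * (Z a t * (evalAt (Rop a z) t).transpose
          + E a t * (evalAt (deriv (deriv (deriv z))) t).transpose))
      (evalAt (Rop a y) t * excW a t * (evalAt (Rop a z) t).transpose
        - evalAt y t * (C₀ a t * (evalAt (Rop a z) t).transpose
          + (E' a t + E' a t + skewPart a t) * (evalAt (deriv (deriv (deriv z))) t).transpose
          + E a t * (evalAt (deriv (deriv (deriv (deriv z)))) t).transpose)) t := by
  have h := ((((MatHasDerivAt.evalAt (deriv y) t).mul (matHasDerivAt_FW a t)).mul
    (MatHasDerivAt.evalAt (Rop a z) t).transpose).sub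
    ((MatHasDerivAt.evalAt y t).mul (((matHasDerivAt_Z a t).mul
      (MatHasDerivAt.evalAt (Rop a z) t).transpose).add
      ((matHasDerivAt_E a t).mul
        (MatHasDerivAt.evalAt (deriv (deriv (deriv z))) t).transpose))))
  have e1 : (evalAt (deriv (Rop a z)) t).transpose
      = (evalAt (F₂ a) t).transpose * (evalAt (deriv (deriv (deriv z))) t).transpose := by
    rw [deriv_Rop, evalAt_mul, Matrix.transpose_mul]
  have e2 : evalAt (Rop a y) t = evalAt y t + evalAt (deriv y) t * evalAt (F₁ a) t
      + evalAt (deriv (deriv y)) t * evalAt (F₂ a) t := by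
    rw [Rop, evalAt_add, evalAt_add, evalAt_mul, evalAt_mul]
  have e3 : evalAt (deriv y) t * FW a t * ((evalAt (F₂ a) t).transpose
      * (evalAt (deriv (deriv (deriv z))) t).transpose)
      = evalAt (deriv y) t * E a t * (evalAt (deriv (deriv (deriv z))) t).transpose := by
    rw [← FW_mul_F₂_transpose]; noncomm_ring
  have e4 : Z a t * ((evalAt (F₂ a) t).transpose
      * (evalAt (deriv (deriv (deriv z))) t).transpose)
      = (E' a t + skewPart a t) * (evalAt (deriv (deriv (deriv z))) t).transpose := by
    rw [← Z_mul_F₂_transpose]; noncomm_ring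
  have e5 : evalAt (deriv (deriv y)) t * FW a t
      = evalAt (deriv (deriv y)) t * evalAt (F₂ a) t * excW a t := by
    rw [← F₂_mul_excW]; noncomm_ring
  intro i j
  refine (h i j).congr_deriv (congrFun (congrFun ?_ i) j)
  rw [e1, e3, e4, e5, e2]
  noncomm_ring

/-- The ratio of the norms of `Q a n` and `P a n`. -/
def normRatio (a : ℝ) (n : ℕ) : Matrix (Fin 2) (Fin 2) ℝ :=
  (((n : ℝ) - 1) * ((n : ℝ) - 2)) • !![1 / (4 * (3 * a ^ 2 + 2) ^ 2), 0;
    0, 1 / (4 * (3 * a ^ 2 + 2) * (a ^ 2 + 2))]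

/-- `Rop` followed by its adjoint has `P a n` as eigenfunction. The identity is polynomial in `H n`
and `K n`, since `derivative_H` and `derivative_K` express all derivatives through these two. -/
theorem adjoint_Q (a : ℝ) (n : ℕ) (t : ℝ) :
    C₀ a t * (evalAt (Q a n) t).transpose
        + (E' a t + E' a t + skewPart a t) * (evalAt (deriv (deriv (deriv (P a n)))) t).transpose
        + E a t * (evalAt (deriv (deriv (deriv (deriv (P a n))))) t).transpose
      = W a t * (evalAt (P a n) t).transpose * normRatio a n := by
  have hb : a ^ 2 + 2 ≠ 0 := by positivity
  have hc : 3 * a ^ 2 + 2 ≠ 0 := by positivity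
  have he : ∀ p q r s : ℝ[X], evalAt !![p, q; r, s] t
      = !![p.eval t, q.eval t; r.eval t, s.eval t] := fun p q r s => by
    ext1 i j
    fin_cases i <;> fin_cases j <;> rfl
  rw [Q, Rop, P_eq, C₀, E', E, skewPart, W_eq, normRatio, F₁, F₂, Enum]
  generalize Real.exp (-t ^ 2) = w
  simp only [deriv_fin_two, evalAt_add, he, Matrix.transpose_add, transpose_fin_two,
    Matrix.mul_fin_two]
  ext1 i j
  fin_cases i <;> fin_cases j <;>
    simp [derivative_H, derivative_K, Matrix.mul_apply, Fin.sum_univ_two, -map_pow,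
      -map_add, -map_mul, -map_sub, -map_div₀] <;>
    field_simp <;> ring

/-- The polynomial `𝔭`. -/
def ppPoly (a : ℝ) : ℝ[X] := C (4 * (a ^ 2 + 2)) * X ^ 4 + C 8 * X ^ 2 + C (3 * a ^ 2 + 2)

theorem eval_ppPoly (a t : ℝ) : (ppPoly a).eval t = pp a t := by
  rw [ppPoly, ← det_F₂, eval_mul, eval_C, eval_det_F₂]

theorem continuous_pp (a : ℝ) : Continuous (pp a) := by
  simpa only [eval_ppPoly] using (ppPoly a).continuous

/-- The numerator of the exceptional weight. -/
def excNum (a : ℝ) : MatPoly 2 :=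
  !![C ((a ^ 2 + 2) / (3 * a ^ 2 + 2) ^ 2) * ((C (a ^ 2) * X ^ 2 + C (3 * a ^ 2 + 1)) * ppPoly a
        + C (a ^ 2 * (3 * a ^ 2 + 2)) * (2 * X ^ 2 - 3)),
      C (a / (3 * a ^ 2 + 2)) * X * (ppPoly a + 8 * (C (a ^ 2 + 2) * X ^ 2 + 1));
    C (a / (3 * a ^ 2 + 2)) * X * (ppPoly a + 8 * (C (a ^ 2 + 2) * X ^ 2 + 1)),
      C (1 / (a ^ 2 + 2)) * (ppPoly a
        + C (2 * a ^ 2) * (C (6 * (a ^ 2 + 2) / (3 * a ^ 2 + 2)) * X ^ 2 - 1))]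

theorem excW_eq (a t : ℝ) :
    excW a t = (Real.exp (-t ^ 2) / pp a t ^ 2) • evalAt (excNum a) t := by
  rw [excW]
  congr 1
  ext1 i j
  fin_cases i <;> fin_cases j <;>
    simp [evalAt, excNum, eval_ppPoly, -map_pow, -map_add, -map_mul, -map_sub, -map_div₀] <;> ring

/-! ### Gaussian bounds and the Gram matrices of the exceptional family. -/

theorem matGaussDom_div {d : ℝ → ℝ} (y : MatPoly 2) (hd : Continuous d)
    (h : ∀ t, 1 ≤ d t) : MatGaussDom (fun t => (Real.exp (-t ^ 2) / d t) • evalAt y t) :=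
  fun i j => by
    have := (GaussDom.gauss.div hd h).eval_mul (y i j)
    simpa only [Matrix.smul_apply, smul_eq_mul, mul_comm, evalAt, Matrix.map_apply] using this

theorem matGaussDom_excW (a : ℝ) : MatGaussDom (excW a) := by
  have := matGaussDom_div (d := fun t => pp a t ^ 2) (excNum a) ((continuous_pp a).pow 2)
    fun t => one_le_pow₀ (one_le_pp a t)
  simpa only [← excW_eq] using this

theorem one_le_const (a t : ℝ) : 1 ≤ 4 * (3 * a ^ 2 + 2) ^ 2 * pp a t := by
  have h1 : (1 : ℝ) ≤ 4 * (3 * a ^ 2 + 2) ^ 2 := by nlinarith [sq_nonneg a, sq_nonneg (a ^ 2)]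
  nlinarith [one_le_pp a t]

theorem matGaussDom_FW (a : ℝ) : MatGaussDom (FW a) :=
  matGaussDom_div (FWnum a) (continuous_const.mul (continuous_pp a)) (one_le_const a)

theorem matGaussDom_Z (a : ℝ) : MatGaussDom (Z a) :=
  matGaussDom_div (Znum a) (continuous_const.mul (continuous_pp a)) (one_le_const a)

theorem matGaussDom_E (a : ℝ) : MatGaussDom (E a) :=
  matGaussDom_div (Enum a) continuous_const
    fun _ => by nlinarith [sq_nonneg a, sq_nonneg (a ^ 2)]

theorem matGaussDom_W (a : ℝ) : MatGaussDom (W a) := by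
  have := MatGaussDom.gauss_smul (!![1 + C (a ^ 2) * X ^ 2, C a * X; C a * X, 1] : MatPoly 2)
  convert! this using 2 with t
  rw [W_eq]
  ext1 i j
  fin_cases i <;> fin_cases j <;> simp [evalAt]

theorem gram_apply_integrable {N : ℕ} {V : ℝ → Matrix (Fin N) (Fin N) ℝ} (hV : MatGaussDom V)
    (y z : MatPoly N) : MatGaussDom (fun t => evalAt y t * V t * (evalAt z t).transpose) :=
  (hV.evalAt_mul y).mul_evalAt_transpose z

theorem MatGaussDom.mul_const {N : ℕ} {V : ℝ → Matrix (Fin N) (Fin N) ℝ} (hV : MatGaussDom V)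
    (A : Matrix (Fin N) (Fin N) ℝ) : MatGaussDom (fun t => V t * A) := by
  simpa only [evalAt_map_C, Matrix.transpose_transpose] using
    hV.mul_evalAt_transpose (A.transpose.map C)

/-- The integrands of the two sides differ by the derivative of an integrable function, whose
integral over the line vanishes. -/
theorem gram_Q (a : ℝ) (n k : ℕ) :
    gram (excW a) (Q a n) (Q a k) = gram (W a) (P a n) (P a k) * normRatio a k := by
  have hD : ∀ t, MatHasDerivAt (fun t => evalAt (deriv (P a n)) t * FW a t *
        (evalAt (Q a k) t).transpose - evalAt (P a n) t * (Z a t * (evalAt (Q a k) t).transpose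
          + E a t * (evalAt (deriv (deriv (deriv (P a k)))) t).transpose))
      (evalAt (Q a n) t * excW a t * (evalAt (Q a k) t).transpose
        - evalAt (P a n) t * W a t * (evalAt (P a k) t).transpose * normRatio a k) t := fun t => by
    have h := integrand_eq a (P a n) (P a k) t
    rw [← Q, ← Q, adjoint_Q] at h
    simpa only [mul_assoc] using h
  have g1 := gram_apply_integrable (matGaussDom_excW a) (Q a n) (Q a k)
  have g2 := gram_apply_integrable (matGaussDom_W a) (P a n) (P a k)
  have g3 := g2.mul_const (normRatio a k)
  have g4 := (gram_apply_integrable (matGaussDom_FW a) (deriv (P a n)) (Q a k)).sub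
    ((((matGaussDom_Z a).mul_evalAt_transpose (Q a k)).add ((matGaussDom_E a).mul_evalAt_transpose
      (deriv (deriv (deriv (P a k)))))).evalAt_mul (P a n))
  ext1 i j
  have h0 := integral_eq_zero_of_hasDerivAt_of_integrable (fun t => hD t i j)
    ((g1.sub g3) i j).integrable (g4 i j).integrable
  simp only [Matrix.sub_apply] at h0
  rw [integral_sub (g1 i j).integrable (g3 i j).integrable, sub_eq_zero] at h0
  rw [gram, Matrix.of_apply, h0]
  simp only [Matrix.mul_apply (N := normRatio a k), gram, Matrix.of_apply]
  rw [integral_finsetSum _ fun l _ => ((g2 i l).integrable.mul_const _)]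
  simp only [integral_mul_const]

/-! ### Positivity of the exceptional weight -/

theorem excW_isSymm (a t : ℝ) : (excW a t).transpose = excW a t := by
  ext1 i j
  fin_cases i <;> fin_cases j <;> simp [excW]

theorem excW_one_one_pos (a t : ℝ) : 0 < excW a t 1 1 := by
  have hp := pp_pos a t
  have h2 : 0 < pp a t + 2 * a ^ 2 * (6 * (a ^ 2 + 2) * t ^ 2 / (3 * a ^ 2 + 2) - 1) := by
    have h3 : 0 ≤ 2 * a ^ 2 * (6 * (a ^ 2 + 2) * t ^ 2 / (3 * a ^ 2 + 2)) := by positivity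
    have h4 : 0 ≤ 4 * (a ^ 2 + 2) * t ^ 4 + 8 * t ^ 2 + a ^ 2 := by positivity
    rw [pp]; linarith
  simp only [excW, Matrix.smul_apply, Matrix.of_apply, Matrix.cons_val_one, smul_eq_mul,
    Matrix.cons_val_fin_one]
  positivity

/-- `det E = (det F₂)² det 𝒲`, and the polynomial part of `E` has a constant positive determinant.
-/
theorem det_excW_pos (a t : ℝ) : 0 < (excW a t).det := by
  have h := congrArg Matrix.det (FW_mul_F₂_transpose a t)
  rw [← F₂_mul_excW, Matrix.det_mul, Matrix.det_mul, Matrix.det_transpose] at h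
  have hE : 0 < (E a t).det := by
    have : (evalAt (Enum a) t).det = (3 * a ^ 2 + 2) / (a ^ 2 + 2) := by
      rw [Matrix.det_fin_two]
      simp [evalAt, Enum, -map_div₀]
      ring
    rw [E, Matrix.det_smul, this]
    positivity
  rw [← h] at hE
  have h3 : 0 ≤ (evalAt (F₂ a) t).det ^ 2 := sq_nonneg _
  by_contra hneg
  push Not at hneg
  nlinarith

theorem excW_form_pos (a t : ℝ) (x : Fin 2 → ℝ) (hx : x ≠ 0) :
    0 < x ⬝ᵥ (excW a t).mulVec x := by
  have h1 := excW_one_one_pos a t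
  have h2 := det_excW_pos a t
  have h3 : excW a t 1 0 = excW a t 0 1 := congrFun (congrFun (excW_isSymm a t) 0) 1
  rw [Matrix.det_fin_two, h3] at h2
  -- Completion of the square with respect to `x 1`; the remainder is `det 𝒲 * x 0 ^ 2`.
  have e : excW a t 1 1 * (x ⬝ᵥ (excW a t).mulVec x)
      = (excW a t 1 1 * x 1 + excW a t 0 1 * x 0) ^ 2
        + (excW a t 0 0 * excW a t 1 1 - excW a t 0 1 * excW a t 0 1) * x 0 ^ 2 := by
    simp only [dotProduct, Matrix.mulVec, Fin.sum_univ_two, h3]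
    ring
  refine pos_of_mul_pos_right ?_ h1.le
  rw [e]
  by_cases h0 : x 0 = 0
  · have h4 : x 1 ≠ 0 := fun h4 => hx (by ext i; fin_cases i <;> assumption)
    rw [h0]
    have := mul_ne_zero h1.ne' h4
    have : 0 < (excW a t 1 1 * x 1) ^ 2 := by positivity
    linarith
  · have : 0 < x 0 ^ 2 := by positivity
    have := mul_pos h2 this
    nlinarith [sq_nonneg (excW a t 1 1 * x 1 + excW a t 0 1 * x 0)]

theorem massOn_form (a : ℝ) (S : Set ℝ) (x : Fin 2 → ℝ) :
    x ⬝ᵥ (massOn (excW a) S).mulVec x = ∫ t in S, x ⬝ᵥ (excW a t).mulVec x := by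
  have hi : ∀ i j, IntegrableOn (fun t => excW a t i j) S := fun i j =>
    (matGaussDom_excW a i j).integrable.integrableOn
  simp only [dotProduct, Matrix.mulVec, massOn, Matrix.of_apply, Finset.mul_sum]
  rw [integral_finsetSum _ fun i _ => integrable_finsetSum _ fun j _ =>
    ((hi i j).mul_const _).const_mul _]
  refine Finset.sum_congr rfl fun i _ => ?_
  rw [integral_finsetSum _ fun j _ => ((hi i j).mul_const _).const_mul _]
  refine Finset.sum_congr rfl fun j _ => ?_
  rw [integral_const_mul, integral_mul_const]

theorem integrable_form (a : ℝ) (x : Fin 2 → ℝ) :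
    Integrable (fun t => x ⬝ᵥ (excW a t).mulVec x) := by
  simp only [dotProduct, Matrix.mulVec]
  exact integrable_finsetSum _ fun i _ => (integrable_finsetSum _ fun j _ =>
    ((matGaussDom_excW a i j).integrable.mul_const _)).const_mul _

theorem massOn_isHermitian (a : ℝ) (S : Set ℝ) : (massOn (excW a) S).IsHermitian := by
  ext i j
  simp only [Matrix.conjTranspose_apply, massOn, Matrix.of_apply, star_trivial]
  exact integral_congr_ae (.of_forall fun t => congrFun (congrFun (excW_isSymm a t) i) j)

theorem massOn_posDef (a : ℝ) {S : Set ℝ} (hS : volume S ≠ 0) :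
    (massOn (excW a) S).PosDef := by
  refine .of_dotProduct_mulVec_pos (massOn_isHermitian a S) fun x hx => ?_
  rw [star_trivial, massOn_form]
  rw [integral_pos_iff_support_of_nonneg (fun t => (excW_form_pos a t x hx).le)
    (integrable_form a x).integrableOn]
  have : Function.support (fun t => x ⬝ᵥ (excW a t).mulVec x) = Set.univ :=
    Set.eq_univ_of_forall fun t => (excW_form_pos a t x hx).ne'
  rw [this, Measure.restrict_apply_univ]
  exact pos_iff_ne_zero.2 hS

theorem isWeightMatrix_excW (a : ℝ) : IsWeightMatrix (excW a) where
  moments n i j := by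
    have := ((matGaussDom_excW a i j).eval_mul (X ^ n)).integrable
    simpa using this
  posSemidef S _ := by
    refine .of_dotProduct_mulVec_nonneg (massOn_isHermitian a S) fun x => ?_
    rw [star_trivial, massOn_form]
    refine integral_nonneg fun t => ?_
    by_cases hx : x = 0
    · simp [hx]
    · exact (excW_form_pos a t x hx).le
  posDef := ⟨Set.univ, .univ, massOn_posDef a (by simp)⟩
  support := by
    refine Set.infinite_univ.mono fun x _ ε hε h => ?_
    have h1 := massOn_posDef a (S := Set.Ioo (x - ε) (x + ε)) (by simp; linarith)
    rw [h] at h1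
    have := h1.det_pos
    simp at this

theorem norm_Q_posDef (a : ℝ) (n : ℕ) (hn : n ∉ ({1, 2} : Finset ℕ)) :
    (gram (excW a) (Q a n) (Q a n)).PosDef := by
  have hpos : 0 < ((n : ℝ) - 1) * ((n : ℝ) - 2) := by
    rcases n with - | - | - | n
    · norm_num
    · simp at hn
    · simp at hn
    · have : (0 : ℝ) ≤ n := n.cast_nonneg
      push_cast
      exact mul_pos (by linarith) (by linarith)
  rw [gram_Q, gram_P, if_pos rfl, normRatio]
  have : (Real.sqrt Real.pi * 2 ^ n * (n.factorial : ℝ)) •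
        !![1 + a ^ 2 * ((n : ℝ) + 1) / 2, 0; 0, 1 + a ^ 2 * (n : ℝ) / 2] *
      ((((n : ℝ) - 1) * ((n : ℝ) - 2)) • !![1 / (4 * (3 * a ^ 2 + 2) ^ 2), 0;
        0, 1 / (4 * (3 * a ^ 2 + 2) * (a ^ 2 + 2))])
      = (Real.sqrt Real.pi * 2 ^ n * (n.factorial : ℝ) * (((n : ℝ) - 1) * ((n : ℝ) - 2))) •
        Matrix.diagonal ![(1 + a ^ 2 * ((n : ℝ) + 1) / 2) * (1 / (4 * (3 * a ^ 2 + 2) ^ 2)),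
          (1 + a ^ 2 * (n : ℝ) / 2) * (1 / (4 * (3 * a ^ 2 + 2) * (a ^ 2 + 2)))] := by
    rw [smul_mul_smul_comm, Matrix.mul_fin_two]
    congr 1
    ext1 i j
    fin_cases i <;> fin_cases j <;> simp
  rw [this]
  have hπ := Real.pi_pos
  refine Matrix.PosDef.smul (Matrix.PosDef.diagonal fun i => ?_) (by positivity)
  fin_cases i <;> simp <;> positivity

/-- The ratio is a right factor in `gram_Q`; all matrices involved are diagonal, so it moves to the
left. -/
theorem gram_Q_self (a : ℝ) (n : ℕ) :
    gram (excW a) (Q a n) (Q a n) = (((n : ℝ) - 1) * ((n : ℝ) - 2)) •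
      (!![1 / (4 * (3 * a ^ 2 + 2) ^ 2), 0; 0, 1 / (4 * (3 * a ^ 2 + 2) * (a ^ 2 + 2))] *
        gram (W a) (P a n) (P a n)) := by
  rw [gram_Q, normRatio, mul_smul_comm, gram_P, if_pos rfl, mul_smul_comm, smul_mul_assoc,
    Matrix.mul_fin_two, Matrix.mul_fin_two]
  congr 2
  ext1 i j
  fin_cases i <;> fin_cases j <;> simp [mul_comm]

/-! ### The range of the differential operator -/

theorem derivative_surjective (p : ℝ[X]) : ∃ q : ℝ[X], derivative q = p := by
  induction p using Polynomial.induction_on' with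
  | add p q hp hq =>
    obtain ⟨P, rfl⟩ := hp
    obtain ⟨Q, rfl⟩ := hq
    exact ⟨P + Q, derivative_add⟩
  | monomial n c =>
    refine ⟨monomial (n + 1) (c / (n + 1)), ?_⟩
    have : (n : ℝ) + 1 ≠ 0 := by positivity
    rw [derivative_monomial]
    push_cast
    rw [div_mul_cancel₀ _ this]

theorem deriv_surjective {N : ℕ} (A : MatPoly N) : ∃ B : MatPoly N, deriv B = A := by
  choose f hf using derivative_surjective
  exact ⟨A.map f, by ext1 i j; simp [deriv, hf]⟩

/-- A threefold antiderivative `y` of `g` gives `(Rop a y)' = g F₂ = v'`. The remaining constant is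
corrected by adding it to `y`, as `Rop` fixes constants. -/
theorem exists_Rop_eq (a : ℝ) (v g : MatPoly 2) (h : deriv v = g * F₂ a) :
    ∃ y, Rop a y = v := by
  obtain ⟨g₁, rfl⟩ := deriv_surjective g
  obtain ⟨g₂, rfl⟩ := deriv_surjective g₁
  obtain ⟨y, rfl⟩ := deriv_surjective g₂
  rw [← deriv_Rop] at h
  have h1 : v = Rop a y + ((v - Rop a y).map (fun p => p.coeff 0)).map C := by
    ext1 i j
    have hd : derivative (v i j - Rop a y i j) = 0 := by
      rw [derivative_sub, sub_eq_zero]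
      exact congrFun (congrFun h i) j
    have := eq_C_of_derivative_eq_zero hd
    simp only [Matrix.add_apply, Matrix.map_apply, Matrix.sub_apply]
    rw [← this]
    ring
  refine ⟨y + ((v - Rop a y).map (fun p => p.coeff 0)).map C, ?_⟩
  rw [Rop_add, ← mul_one (Matrix.map _ C), Rop_map_C_mul]
  have : Rop a 1 = 1 := by
    rw [Rop, ← Matrix.map_one C (map_zero C) (map_one C), deriv_map_C, deriv_zero]
    simp
  rw [this, mul_one]
  exact h1.symm

theorem deriv_smul {N : ℕ} (p : ℝ[X]) (A : MatPoly N) :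
    deriv (p • A) = derivative p • A + p • deriv A := by
  ext1 i j
  simp [deriv]

theorem exists_Rop_eq_smul (a : ℝ) (w : MatPoly 2) : ∃ y, Rop a y = ppPoly a ^ 2 • w := by
  -- `(𝔭² w)' = 𝔭 (2 𝔭' w + 𝔭 w')`, and the outer `𝔭 = 16 (a² + 2) det F₂` is split as a constant
  -- times `adjugate F₂ * F₂`.
  refine exists_Rop_eq a _ (C (16 * (a ^ 2 + 2)) • ((C 2 * derivative (ppPoly a)) • w
    + ppPoly a • deriv w) * (F₂ a).adjugate) ?_
  rw [mul_assoc, Matrix.adjugate_mul, mul_smul_comm, mul_one, smul_smul, mul_comm (F₂ a).det,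
    det_F₂, ← ppPoly, deriv_smul, derivative_pow]
  ext1 i j
  simp only [Matrix.add_apply, Matrix.smul_apply, smul_eq_mul, Nat.cast_ofNat]
  ring

/-- Each `P a n` has an invertible leading coefficient, so subtracting a left multiple of it removes
the top degree. -/
theorem exists_eq_sum_P (a : ℝ) (N : ℕ) (y : MatPoly 2) (hy : ∀ i j, (y i j).degree < N) :
    ∃ A : ℕ → Matrix (Fin 2) (Fin 2) ℝ, y = ∑ n ∈ Finset.range N, (A n).map C * P a n := by
  induction N generalizing y with
  | zero =>
    refine ⟨0, ?_⟩
    ext1 i j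
    have := hy i j
    rw [Nat.cast_zero, ← not_le, zero_le_degree_iff, not_not] at this
    simpa using this
  | succ N ih =>
    set B : Matrix (Fin 2) (Fin 2) ℝ := y.map (fun p => p.coeff N) with hB
    set A₀ := B * (leadP a N)⁻¹ with hA₀
    have hlead : IsMatLead y N B := fun i j =>
      ⟨natDegree_le_iff_coeff_eq_zero.2 ((degree_lt_iff_coeff_zero _ _).1 (hy i j)), rfl⟩
    have hC : IsMatLead ((-A₀).map C) 0 (-A₀) := fun i j => IsLead.const _
    have h1 := hlead.add (by simpa using hC.mul (isMatLead_P a N))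
    have h0 : B + -(A₀ * leadP a N) = 0 := by
      rw [hA₀, mul_assoc, Matrix.nonsing_inv_mul _ (isUnit_det_leadP a N), mul_one, add_neg_cancel]
    rw [h0] at h1
    obtain ⟨A, hA⟩ := ih (y + (-A₀).map C * P a N) fun i j => by
      obtain ⟨h2, h3⟩ := h1 i j
      refine (degree_lt_iff_coeff_zero _ _).2 fun m hm => ?_
      rcases hm.eq_or_lt with rfl | hm
      · exact h3
      · exact natDegree_le_iff_coeff_eq_zero.1 h2 m hm
    refine ⟨fun n => if n = N then A₀ else A n, ?_⟩
    simp only [Finset.sum_range_succ, if_true]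
    have h5 : ∑ n ∈ Finset.range N, (if n = N then A₀ else A n).map C * P a n
        = ∑ n ∈ Finset.range N, (A n).map C * P a n :=
      Finset.sum_congr rfl fun n hn => by rw [if_neg (Finset.mem_range.1 hn).ne]
    have h6 : (-A₀).map C = -(A₀.map C) := by ext1 i j; simp
    rw [h5, ← hA, h6]
    noncomm_ring

theorem exists_sum_Q_eq (a : ℝ) (w : MatPoly 2) :
    ∃ (s : Finset ℕ) (A : ℕ → Matrix (Fin 2) (Fin 2) ℝ), Disjoint s {1, 2} ∧
      ∀ t, ∑ n ∈ s, A n * evalAt (Q a n) t = pp a t ^ 2 • evalAt w t := by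
  obtain ⟨y, hy⟩ := exists_Rop_eq_smul a w
  obtain ⟨A, hA⟩ := exists_eq_sum_P a (∑ i, ∑ j, (y i j).natDegree + 1) y fun i j => by
    refine degree_le_natDegree.trans_lt ?_
    have h1 := Finset.single_le_sum (f := fun j => (y i j).natDegree) (fun _ _ => Nat.zero_le _)
      (Finset.mem_univ j)
    have h2 := Finset.single_le_sum (f := fun i => ∑ j, (y i j).natDegree)
      (fun _ _ => Nat.zero_le _) (Finset.mem_univ i)
    exact_mod_cast Nat.lt_succ_of_le (h1.trans h2)
  have hsum : ∀ s : Finset ℕ, Rop a (∑ n ∈ s, (A n).map C * P a n)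
      = ∑ n ∈ s, (A n).map C * Q a n := fun s => by
    induction s using Finset.induction_on with
    | empty => simp [Rop, deriv_zero]
    | insert n s hn ih =>
      rw [Finset.sum_insert hn, Finset.sum_insert hn, Rop_add, ih, Rop_map_C_mul, Q]
  have hev : ∀ (s : Finset ℕ) (t : ℝ), evalAt (∑ n ∈ s, (A n).map C * Q a n) t
      = ∑ n ∈ s, A n * evalAt (Q a n) t := fun s t => by
    induction s using Finset.induction_on with
    | empty => ext1 i j; simp [evalAt]
    | insert n s hn ih =>
      rw [Finset.sum_insert hn, Finset.sum_insert hn, evalAt_add, ih, evalAt_mul, evalAt_map_C]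
  rw [hA, hsum] at hy
  -- The forbidden indices may be deleted because `Q a 1` and `Q a 2` vanish.
  refine ⟨(Finset.range (∑ i, ∑ j, (y i j).natDegree + 1)).filter (· ∉ ({1, 2} : Finset ℕ)), A,
    Finset.disjoint_left.2 fun n hn => (Finset.mem_filter.1 hn).2, fun t => ?_⟩
  rw [← hev]
  have : ∑ n ∈ (Finset.range (∑ i, ∑ j, (y i j).natDegree + 1)).filter
      (· ∉ ({1, 2} : Finset ℕ)), (A n).map C * Q a n
      = ∑ n ∈ Finset.range (∑ i, ∑ j, (y i j).natDegree + 1), (A n).map C * Q a n := by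
    refine Finset.sum_filter_of_ne fun n _ hn hmem => hn ?_
    simp only [Finset.mem_insert, Finset.mem_singleton] at hmem
    rcases hmem with rfl | rfl
    · rw [Q_one, mul_zero]
    · rw [Q_two, mul_zero]
  rw [this, hy]
  ext1 i j
  simp [evalAt, eval_ppPoly]

/-! ### Density of the polynomials -/

open ProbabilityTheory in
/-- Finite measures with all exponential moments are determined by their moments. -/
theorem measure_ext_of_moments {μ ν : Measure ℝ} [IsFiniteMeasure μ] [IsFiniteMeasure ν]
    (hμ : ∀ c : ℝ, Integrable (fun t => Real.exp (c * t)) μ)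
    (hν : ∀ c : ℝ, Integrable (fun t => Real.exp (c * t)) ν)
    (h : ∀ n : ℕ, ∫ t, t ^ n ∂μ = ∫ t, t ^ n ∂ν) : μ = ν := by
  have hs : ∀ {ρ : Measure ℝ}, (∀ c : ℝ, Integrable (fun t => Real.exp (c * t)) ρ) →
      ∀ x : ℝ, x ∈ interior (integrableExpSet id ρ) := fun {ρ} hρ x => by
    have : integrableExpSet id ρ = Set.univ := Set.eq_univ_of_forall hρ
    rw [this, interior_univ]
    trivial
  have hd : ∀ {ρ : Measure ℝ}, (∀ c : ℝ, Integrable (fun t => Real.exp (c * t)) ρ) →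
      Differentiable ℂ (complexMGF id ρ) := fun {ρ} hρ z =>
    (hasDerivAt_complexMGF (hs hρ z.re)).differentiableAt
  refine Measure.ext_of_complexMGF_id_eq (funext fun z => ?_)
  -- Exponential moments make the complex moment generating function entire, and its Taylor
  -- coefficients at 0 are determined by the moments.
  rw [← Complex.taylorSeries_eq_of_entire' 0 z (hd hμ),
    ← Complex.taylorSeries_eq_of_entire' 0 z (hd hν)]
  congr 1
  funext n
  rw [iteratedDeriv_complexMGF (hs hμ _), iteratedDeriv_complexMGF (hs hν _)]
  have e : ∀ ρ : Measure ℝ, ∫ t, ((id t : ℝ) : ℂ) ^ n * Complex.exp (0 * (id t : ℝ)) ∂ρ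
      = ((∫ t, t ^ n ∂ρ : ℝ) : ℂ) := fun ρ => by
    rw [← integral_complex_ofReal]
    simp
  rw [e, e, h]

/-- All moments of a measure with exponential moments are finite. -/
theorem integrable_eval_of_exp {μ : Measure ℝ}
    (hμ : ∀ c : ℝ, Integrable (fun t => Real.exp (c * t)) μ) (p : ℝ[X]) :
    Integrable (fun t => p.eval t) μ := by
  induction p using Polynomial.induction_on' with
  | add p q hp hq => exact (hp.add hq).congr (.of_forall fun t => (eval_add ..).symm)
  | monomial n c =>
    have h := ProbabilityTheory.integrable_pow_of_mem_interior_integrableExpSet (X := id) (μ := μ)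
      (by
        have : ProbabilityTheory.integrableExpSet id μ = Set.univ := Set.eq_univ_of_forall hμ
        rw [this, interior_univ]; trivial) n
    exact (h.const_mul c).congr (.of_forall fun t => (eval_monomial ..).symm)

theorem memLp_eval_of_exp {μ : Measure ℝ}
    (hμ : ∀ c : ℝ, Integrable (fun t => Real.exp (c * t)) μ) (p : ℝ[X]) :
    MemLp (fun t => p.eval t) 2 μ := by
  rw [memLp_two_iff_integrable_sq p.continuous.aestronglyMeasurable]
  exact (integrable_eval_of_exp hμ (p ^ 2)).congr (.of_forall fun t => eval_pow ..)

theorem memLp_exp_of_exp {μ : Measure ℝ}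
    (hμ : ∀ c : ℝ, Integrable (fun t => Real.exp (c * t)) μ) (c : ℝ) :
    MemLp (fun t => Real.exp (c * t)) 2 μ := by
  rw [memLp_two_iff_integrable_sq (by fun_prop)]
  convert! hμ (2 * c) using 2 with t
  rw [← Real.exp_nat_mul]
  push_cast
  ring_nf

/-- The positive and negative parts of `g`, taken as densities, define finite measures with equal
moments, hence equal measures. Exponentials and polynomials are integrable against them as products
of two `L²` functions. -/
theorem ae_eq_zero_of_moments {μ : Measure ℝ}
    (hμ : ∀ c : ℝ, Integrable (fun t => Real.exp (c * t)) μ) {g : ℝ → ℝ} (hg : MemLp g 2 μ)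
    (h : ∀ n : ℕ, ∫ t, t ^ n * g t ∂μ = 0) : g =ᵐ[μ] 0 := by
  have hpos : MemLp (fun t => max (g t) 0) 2 μ := hg.pos_part
  have hneg : MemLp (fun t => max (-g t) 0) 2 μ := hg.neg_part
  have : IsFiniteMeasure μ := by
    have := hμ 0
    simpa [integrable_const_iff] using this
  have hint : ∀ {k : ℝ → ℝ}, MemLp k 2 μ → Integrable k μ := fun hk =>
    hk.integrable one_le_two
  have key : ∀ {k : ℝ → ℝ}, MemLp k 2 μ → (∀ t, 0 ≤ k t) → ∀ {f : ℝ → ℝ}, MemLp f 2 μ →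
      Integrable f (μ.withDensity fun t => ENNReal.ofReal (k t)) ∧
      ∫ t, f t ∂(μ.withDensity fun t => ENNReal.ofReal (k t)) = ∫ t, f t * k t ∂μ := by
    intro k hk hk0 f hf
    have hkm : AEMeasurable (fun t => ENNReal.ofReal (k t)) μ :=
      hk.aestronglyMeasurable.aemeasurable.ennreal_ofReal
    constructor
    · rw [integrable_withDensity_iff_integrable_smul₀' hkm
        (.of_forall fun t => ENNReal.ofReal_lt_top)]
      refine (hk.integrable_mul hf).congr (.of_forall fun t => ?_)
      simp [ENNReal.toReal_ofReal (hk0 t)]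
    · rw [integral_withDensity_eq_integral_toReal_smul₀ hkm
        (.of_forall fun t => ENNReal.ofReal_lt_top)]
      refine integral_congr_ae (.of_forall fun t => ?_)
      simp [ENNReal.toReal_ofReal (hk0 t), mul_comm]
  have hp0 : ∀ t, 0 ≤ max (g t) 0 := fun t => le_max_right _ _
  have hn0 : ∀ t, 0 ≤ max (-g t) 0 := fun t => le_max_right _ _
  have f1 : IsFiniteMeasure (μ.withDensity fun t => ENNReal.ofReal (max (g t) 0)) :=
    isFiniteMeasure_withDensity_ofReal (hint hpos).2
  have f2 : IsFiniteMeasure (μ.withDensity fun t => ENNReal.ofReal (max (-g t) 0)) :=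
    isFiniteMeasure_withDensity_ofReal (hint hneg).2
  have heq := measure_ext_of_moments
    (μ := μ.withDensity fun t => ENNReal.ofReal (max (g t) 0))
    (ν := μ.withDensity fun t => ENNReal.ofReal (max (-g t) 0))
    (fun c => (key hpos hp0 (memLp_exp_of_exp hμ c)).1)
    (fun c => (key hneg hn0 (memLp_exp_of_exp hμ c)).1)
    (fun n => by
      have hX : MemLp (fun t : ℝ => t ^ n) 2 μ := by
        simpa using memLp_eval_of_exp hμ (X ^ n)
      rw [(key hpos hp0 hX).2, (key hneg hn0 hX).2, ← sub_eq_zero,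
        ← integral_sub (f := fun t => t ^ n * max (g t) 0) (g := fun t => t ^ n * max (-g t) 0)
          (hX.integrable_mul hpos) (hX.integrable_mul hneg)]
      refine Eq.trans (integral_congr_ae (.of_forall fun t => ?_)) (h n)
      simp only
      rw [← mul_sub]
      congr 1
      rcases le_total (g t) 0 with h0 | h0
      · rw [max_eq_right h0, max_eq_left (by linarith)]; ring
      · rw [max_eq_left h0, max_eq_right (by linarith)]; ring)
  have hae := (withDensity_eq_iff hpos.aestronglyMeasurable.aemeasurable.ennreal_ofReal
    hneg.aestronglyMeasurable.aemeasurable.ennreal_ofReal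
    (by
      have := (hint hpos).lintegral_lt_top
      exact this.ne)).1 heq
  filter_upwards [hae] with t ht
  rw [ENNReal.ofReal_eq_ofReal_iff (hp0 t) (hn0 t)] at ht
  rcases le_total (g t) 0 with h0 | h0
  · rw [max_eq_right h0, max_eq_left (by linarith)] at ht
    simp only [Pi.zero_apply]; linarith
  · rw [max_eq_left h0, max_eq_right (by linarith)] at ht
    exact ht

/-- The polynomials are dense in `L²(μ)` if `μ` has all exponential moments. -/
theorem exists_polynomial_lintegral_lt {μ : Measure ℝ}
    (hμ : ∀ c : ℝ, Integrable (fun t => Real.exp (c * t)) μ) {f : ℝ → ℝ} (hf : MemLp f 2 μ)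
    {ε : ℝ} (hε : 0 < ε) :
    ∃ p : ℝ[X], ∫⁻ t, ENNReal.ofReal ((f t - p.eval t) ^ 2) ∂μ < ENNReal.ofReal ε := by
  let S : Submodule ℝ (Lp ℝ 2 μ) := LinearMap.range
    ({ toFun := fun p => (memLp_eval_of_exp hμ p).toLp _
       map_add' := fun p q => by
        rw [← MemLp.toLp_add]; congr 1; funext t; simp
       map_smul' := fun c p => by
        rw [RingHom.id_apply, ← MemLp.toLp_const_smul]; congr 1; funext t; simp } :
      ℝ[X] →ₗ[ℝ] Lp ℝ 2 μ)
  have hS : S.topologicalClosure = ⊤ := by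
    -- It suffices that the orthogonal complement be trivial; an element orthogonal to all monomials
    -- has vanishing moments.
    rw [Submodule.topologicalClosure_eq_top_iff, Submodule.eq_bot_iff]
    intro g hg
    rw [Submodule.mem_orthogonal] at hg
    refine (Lp.eq_zero_iff_ae_eq_zero).2 (ae_eq_zero_of_moments hμ (Lp.memLp g) fun n => ?_)
    have h1 := hg _ ⟨X ^ n, rfl⟩
    rw [L2.inner_def] at h1
    rw [← h1]
    refine integral_congr_ae ?_
    filter_upwards [(memLp_eval_of_exp hμ (X ^ n)).coeFn_toLp] with t ht
    have h2 : ((memLp_eval_of_exp hμ (X ^ n)).toLp _ : ℝ → ℝ) t = t ^ n := by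
      rw [ht]; simp
    simp only [LinearMap.coe_mk, AddHom.coe_mk, h2]
    simp [mul_comm]
  have hmem : hf.toLp f ∈ closure (S : Set (Lp ℝ 2 μ)) := by
    rw [← Submodule.topologicalClosure_coe, hS]
    trivial
  obtain ⟨_, ⟨p, rfl⟩, hp⟩ := Metric.mem_closure_iff.1 hmem (Real.sqrt ε) (Real.sqrt_pos.2 hε)
  refine ⟨p, ?_⟩
  have hsub : MemLp (fun t => f t - p.eval t) 2 μ := hf.sub (memLp_eval_of_exp hμ p)
  have hdist : ‖hsub.toLp _‖ < Real.sqrt ε := by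
    rw [dist_eq_norm] at hp
    exact hp
  have hint := (memLp_two_iff_integrable_sq hsub.aestronglyMeasurable).1 hsub
  rw [← ofReal_integral_eq_lintegral_ofReal hint (.of_forall fun t => sq_nonneg _)]
  refine (ENNReal.ofReal_lt_ofReal_iff hε).2 ?_
  have h3 : ‖hsub.toLp _‖ ^ 2 = ∫ t, (f t - p.eval t) ^ 2 ∂μ := by
    rw [← real_inner_self_eq_norm_sq, L2.inner_def]
    refine integral_congr_ae ?_
    filter_upwards [hsub.coeFn_toLp] with t ht
    rw [ht]
    simp [pow_two]
  rw [← h3, ← Real.sq_sqrt hε.le]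
  exact pow_lt_pow_left₀ hdist (norm_nonneg _) two_ne_zero

/-! ### Completeness -/

theorem GaussDom.integrable_exp_mul {f : ℝ → ℝ} (hf : GaussDom f) (c : ℝ) :
    Integrable (fun t => Real.exp (c * t) * f t) := by
  obtain ⟨hc, p, hp⟩ := hf
  -- Completion of the square, `c t - t² = c² / 4 - (t - c / 2)²`; the composition undoes the shift
  -- inside the polynomial.
  have h := ((integrable_eval_mul_gauss (p.comp (X + C (c / 2)))).comp_sub_right
    (c / 2)).const_mul (Real.exp (c ^ 2 / 4))
  refine h.mono' (by fun_prop) (.of_forall fun t => ?_)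
  have e : Real.exp (c ^ 2 / 4) * Real.exp (-(t - c / 2) ^ 2)
      = Real.exp (c * t) * Real.exp (-t ^ 2) := by
    rw [← Real.exp_add, ← Real.exp_add]
    ring_nf
  rw [norm_mul, Real.norm_eq_abs, abs_of_pos (Real.exp_pos _)]
  refine (mul_le_mul_of_nonneg_left (hp t) (Real.exp_pos _).le).trans (le_of_eq ?_)
  simp only [eval_comp, eval_add, eval_X, eval_C, sub_add_cancel]
  linear_combination -(p.eval t) * e

theorem trace_mul_mul_transpose {N : ℕ} (V D : Matrix (Fin N) (Fin N) ℝ) :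
    (D * V * D.transpose).trace = ∑ i, D i ⬝ᵥ V.mulVec (D i) := by
  simp only [Matrix.trace, Matrix.diag]
  refine Finset.sum_congr rfl fun i _ => ?_
  rw [mul_assoc, Matrix.mul_apply]
  simp only [dotProduct, Matrix.mulVec, Matrix.mul_apply, Matrix.transpose_apply]

theorem excW_form_nonneg (a t : ℝ) (x : Fin 2 → ℝ) : 0 ≤ x ⬝ᵥ (excW a t).mulVec x := by
  by_cases hx : x = 0
  · simp [hx]
  · exact (excW_form_pos a t x hx).le

theorem trace_excW_nonneg (a t : ℝ) (D : Matrix (Fin 2) (Fin 2) ℝ) :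
    0 ≤ (D * excW a t * D.transpose).trace := by
  rw [trace_mul_mul_transpose]
  exact Finset.sum_nonneg fun i _ => excW_form_nonneg a t _

/-- The difference of the two sides is the nonnegative form at `A - B`. -/
theorem trace_excW_add_le (a t : ℝ) (A B : Matrix (Fin 2) (Fin 2) ℝ) :
    ((A + B) * excW a t * (A + B).transpose).trace
      ≤ 2 * (A * excW a t * A.transpose).trace + 2 * (B * excW a t * B.transpose).trace := by
  have h := trace_excW_nonneg a t (A - B)
  simp only [Matrix.transpose_sub, Matrix.transpose_add, add_mul, mul_add, sub_mul, mul_sub,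
    Matrix.trace_add, Matrix.trace_sub] at h ⊢
  linarith

theorem trace_excW_le (a t : ℝ) (D : Matrix (Fin 2) (Fin 2) ℝ) :
    (D * excW a t * D.transpose).trace ≤ (excW a t).trace * ∑ i, ∑ j, D i j ^ 2 := by
  rw [trace_mul_mul_transpose, Finset.mul_sum]
  refine Finset.sum_le_sum fun i _ => ?_
  -- In dimension two, `tr 𝒲 |x|² - xᵀ 𝒲 x` is the form evaluated at `x` rotated by a right angle.
  have h := excW_form_nonneg a t ![D i 1, -D i 0]
  have h3 : excW a t 1 0 = excW a t 0 1 := congrFun (congrFun (excW_isSymm a t) 0) 1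
  simp only [dotProduct, Matrix.mulVec, Fin.sum_univ_two, Matrix.trace, Matrix.diag, h3,
    Matrix.cons_val_zero, Matrix.cons_val_one] at h ⊢
  linarith

theorem trace_excW_self_nonneg (a t : ℝ) : 0 ≤ (excW a t).trace := by
  simpa using trace_excW_nonneg a t 1

/-- The scalar measure that dominates `pp ^ 4 𝒲(t) dt`. -/
def dominatingMeasure (a : ℝ) : Measure ℝ :=
  volume.withDensity fun t => ENNReal.ofReal (pp a t ^ 4 * (excW a t).trace)

theorem gaussDom_density (a : ℝ) : GaussDom (fun t => pp a t ^ 4 * (excW a t).trace) := by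
  have h : GaussDom (fun t => (excW a t).trace) := by
    simpa only [Matrix.trace, Matrix.diag] using
      GaussDom.sum (s := Finset.univ) fun i _ => matGaussDom_excW a i i
  convert! h.eval_mul (ppPoly a ^ 4) using 3
  rw [eval_pow, eval_ppPoly]

theorem density_nonneg (a t : ℝ) : 0 ≤ pp a t ^ 4 * (excW a t).trace :=
  mul_nonneg (pow_nonneg (pp_pos a t).le 4) (trace_excW_self_nonneg a t)

theorem integrable_exp_dominatingMeasure (a c : ℝ) :
    Integrable (fun t => Real.exp (c * t)) (dominatingMeasure a) := by
  rw [dominatingMeasure, integrable_withDensity_iff_integrable_smul₀'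
    (gaussDom_density a).1.measurable.ennreal_ofReal.aemeasurable
    (.of_forall fun t => ENNReal.ofReal_lt_top)]
  refine ((gaussDom_density a).integrable_exp_mul c).congr (.of_forall fun t => ?_)
  simp only [ENNReal.toReal_ofReal (density_nonneg a t), smul_eq_mul]
  ring

theorem sqNorm_add_le (a : ℝ) {A B : ℝ → Matrix (Fin 2) (Fin 2) ℝ}
    (hA : ∀ i j, Measurable fun t => A t i j) :
    sqNorm (excW a) (fun t => A t + B t) ≤ 2 * sqNorm (excW a) A + 2 * sqNorm (excW a) B := by
  have hm : Measurable fun t => ENNReal.ofReal (A t * excW a t * (A t).transpose).trace := by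
    refine Measurable.ennreal_ofReal ?_
    simp only [Matrix.trace, Matrix.diag, Matrix.mul_apply, Matrix.transpose_apply]
    have := fun i j => (matGaussDom_excW a i j).1.measurable
    fun_prop
  rw [sqNorm, sqNorm, sqNorm, ← lintegral_const_mul' _ _ (by simp),
    ← lintegral_const_mul' _ _ (by simp), ← lintegral_add_left (hm.const_mul 2)]
  refine lintegral_mono fun t => ?_
  refine (ENNReal.ofReal_le_ofReal (trace_excW_add_le a t (A t) (B t))).trans (le_of_eq ?_)
  have h1 := trace_excW_nonneg a t (A t)
  have h2 := trace_excW_nonneg a t (B t)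
  rw [ENNReal.ofReal_add (by positivity) (by positivity), ENNReal.ofReal_mul two_pos.le,
    ENNReal.ofReal_mul two_pos.le, ENNReal.ofReal_ofNat]

/-- Bounded functions are approximated by `pp ^ 2` times matrix polynomials. -/
theorem exists_matPoly_sqNorm_lt (a : ℝ) {G : ℝ → Matrix (Fin 2) (Fin 2) ℝ}
    (hG : ∀ i j, Measurable fun t => G t i j) {m : ℝ} (hm : ∀ t i j, |G t i j| ≤ m)
    {ε : ℝ} (hε : 0 < ε) :
    ∃ w : MatPoly 2, sqNorm (excW a) (fun t => G t - pp a t ^ 2 • evalAt w t)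
      < ENNReal.ofReal ε := by
  have hexp := integrable_exp_dominatingMeasure a
  have hfin : IsFiniteMeasure (dominatingMeasure a) := by
    have := hexp 0
    simpa [integrable_const_iff] using this
  have hpm := (continuous_pp a).measurable
  -- Approximating `G / 𝔭²` by `w` in `L²(𝔭⁴ tr 𝒲 dt)` controls `G - 𝔭² w` in `L²(𝒲)`; the quotient
  -- stays bounded as `𝔭 ≥ 1`.
  have hmem : ∀ i j, MemLp (fun t => G t i j / pp a t ^ 2) 2 (dominatingMeasure a) := fun i j => by
    refine MemLp.of_bound ((hG i j).div (hpm.pow_const 2)).aestronglyMeasurable m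
      (.of_forall fun t => ?_)
    have h1 : 1 ≤ pp a t ^ 2 := one_le_pow₀ (one_le_pp a t)
    rw [Real.norm_eq_abs, abs_div, abs_of_pos (one_pos.trans_le h1)]
    exact (div_le_self (abs_nonneg _) h1).trans (hm t i j)
  choose w hw using fun i j => exists_polynomial_lintegral_lt hexp (hmem i j)
    (ε := ε / 4) (by positivity)
  refine ⟨Matrix.of w, ?_⟩
  have hterm : ∀ i j, Measurable fun t => ENNReal.ofReal (pp a t ^ 4 * (excW a t).trace)
      * ENNReal.ofReal ((G t i j / pp a t ^ 2 - (w i j).eval t) ^ 2) := fun i j => by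
    have h1 := (gaussDom_density a).1.measurable
    have h2 := (w i j).continuous.measurable
    have h3 := hG i j
    fun_prop
  have hle : sqNorm (excW a) (fun t => G t - pp a t ^ 2 • evalAt (Matrix.of w) t)
      ≤ ∑ i, ∑ j, ∫⁻ t, ENNReal.ofReal ((G t i j / pp a t ^ 2 - (w i j).eval t) ^ 2)
        ∂(dominatingMeasure a) := by
    have e : ∀ i j, ∫⁻ t, ENNReal.ofReal ((G t i j / pp a t ^ 2 - (w i j).eval t) ^ 2)
        ∂(dominatingMeasure a) = ∫⁻ t, ENNReal.ofReal (pp a t ^ 4 * (excW a t).trace)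
          * ENNReal.ofReal ((G t i j / pp a t ^ 2 - (w i j).eval t) ^ 2) := fun i j => by
      have h2 := (w i j).continuous.measurable
      have h3 := hG i j
      rw [dominatingMeasure, lintegral_withDensity_eq_lintegral_mul _
        (gaussDom_density a).1.measurable.ennreal_ofReal (by fun_prop)]
      rfl
    simp only [e]
    simp only [← lintegral_finsetSum _ fun j _ => hterm _ j]
    rw [← lintegral_finsetSum _ fun i _ => Finset.measurable_sum _ fun j _ => hterm i j]
    refine lintegral_mono fun t => ?_
    refine (ENNReal.ofReal_le_ofReal (trace_excW_le a t _)).trans (le_of_eq ?_)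
    have hp := (pp_pos a t).ne'
    have e2 : (excW a t).trace * ∑ i, ∑ j, (G t - pp a t ^ 2 • evalAt (Matrix.of w) t) i j ^ 2
        = ∑ i, ∑ j, pp a t ^ 4 * (excW a t).trace
          * (G t i j / pp a t ^ 2 - (w i j).eval t) ^ 2 := by
      simp only [Finset.mul_sum]
      refine Finset.sum_congr rfl fun i _ => Finset.sum_congr rfl fun j _ => ?_
      simp only [Matrix.sub_apply, Matrix.smul_apply, smul_eq_mul, evalAt, Matrix.map_apply,
        Matrix.of_apply]
      field_simp
    rw [e2, ENNReal.ofReal_sum_of_nonneg fun i _ => Finset.sum_nonneg fun j _ =>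
      mul_nonneg (density_nonneg a t) (sq_nonneg _)]
    refine Finset.sum_congr rfl fun i _ => ?_
    rw [ENNReal.ofReal_sum_of_nonneg fun j _ => mul_nonneg (density_nonneg a t) (sq_nonneg _)]
    exact Finset.sum_congr rfl fun j _ => ENNReal.ofReal_mul (density_nonneg a t)
  refine hle.trans_lt ?_
  have e4 : ENNReal.ofReal ε = ∑ _i : Fin 2, ∑ _j : Fin 2, ENNReal.ofReal (ε / 4) := by
    simp only [Fin.sum_univ_two]
    rw [← ENNReal.ofReal_add (by positivity) (by positivity),
      ← ENNReal.ofReal_add (by positivity) (by positivity)]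
    ring_nf
  rw [e4]
  simp only [Fin.sum_univ_two]
  exact ENNReal.add_lt_add (ENNReal.add_lt_add (hw 0 0) (hw 0 1))
    (ENNReal.add_lt_add (hw 1 0) (hw 1 1))

/-- Elements of `L²(𝒲)` are approximated by bounded functions. -/
theorem exists_bounded_sqNorm_lt (a : ℝ) {G : ℝ → Matrix (Fin 2) (Fin 2) ℝ}
    (hG : ∀ i j, Measurable fun t => G t i j) (hfin : sqNorm (excW a) G < ⊤)
    {ε : ℝ} (hε : 0 < ε) :
    ∃ (B : ℝ → Matrix (Fin 2) (Fin 2) ℝ) (m : ℝ), (∀ i j, Measurable fun t => B t i j) ∧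
      (∀ t i j, |B t i j| ≤ m) ∧ sqNorm (excW a) (fun t => G t - B t) < ENNReal.ofReal ε := by
  classical
  -- Truncation: every point lies in `T m` for all large `m`, so the norm carried by the complement
  -- tends to 0 by dominated convergence.
  let T : ℕ → Set ℝ := fun m => {t | ∀ i j, |G t i j| ≤ m}
  have hT : ∀ m, MeasurableSet (T m) := fun m => by
    have : T m = ⋂ i, ⋂ j, {t | |G t i j| ≤ m} := by ext t; simp [T]
    rw [this]
    exact MeasurableSet.iInter fun i => MeasurableSet.iInter fun j =>
      measurableSet_le (hG i j).abs measurable_const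
  let φ : ℝ → ENNReal := fun t => ENNReal.ofReal (G t * excW a t * (G t).transpose).trace
  have hφ : Measurable φ := by
    refine Measurable.ennreal_ofReal ?_
    simp only [Matrix.trace, Matrix.diag, Matrix.mul_apply, Matrix.transpose_apply]
    have := fun i j => (matGaussDom_excW a i j).1.measurable
    fun_prop
  have hlim : Filter.Tendsto (fun m => ∫⁻ t, (T m)ᶜ.indicator φ t) Filter.atTop (nhds 0) := by
    have h := tendsto_lintegral_of_dominated_convergence (μ := volume)
      (F := fun m => (T m)ᶜ.indicator φ) (f := fun _ => 0) φ
      (fun m => hφ.indicator (hT m).compl)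
      (fun m => .of_forall fun t => Set.indicator_le_self _ _ _) hfin.ne
      (.of_forall fun t => by
        obtain ⟨M, hM⟩ := exists_nat_ge (∑ i, ∑ j, |G t i j|)
        refine tendsto_const_nhds.congr' ?_
        filter_upwards [Filter.eventually_ge_atTop M] with m hm
        have hmem : t ∈ T m := fun i j => by
          have h1 := Finset.single_le_sum (f := fun j => |G t i j|) (fun _ _ => abs_nonneg _)
            (Finset.mem_univ j)
          have h2 := Finset.single_le_sum (f := fun i => ∑ j, |G t i j|)
            (fun _ _ => Finset.sum_nonneg fun _ _ => abs_nonneg _) (Finset.mem_univ i)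
          have h3 : (M : ℝ) ≤ m := Nat.cast_le.2 hm
          linarith
        rw [Set.indicator_of_notMem]
        exact fun h => h hmem)
    simpa using h
  obtain ⟨m, hm⟩ := (hlim.eventually_lt_const (ENNReal.ofReal_pos.2 hε)).exists
  refine ⟨fun t => if t ∈ T m then G t else 0, m, fun i j => ?_, fun t i j => ?_, ?_⟩
  · have : (fun t => (if t ∈ T m then G t else 0) i j)
        = fun t => if t ∈ T m then G t i j else 0 := by
      funext t
      split_ifs <;> rfl
    rw [this]
    exact Measurable.ite (hT m) (hG i j) measurable_const
  · by_cases h : t ∈ T m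
    · simpa only [if_pos h] using h i j
    · simp [if_neg h]
  · refine lt_of_eq_of_lt ?_ hm
    refine lintegral_congr fun t => ?_
    by_cases h : t ∈ T m
    · simp [h]
    · simp [h, φ]

/-- Truncation, then approximation by `𝔭² w`, which is a finite combination of the allowed `Q a n`
by `exists_sum_Q_eq`. -/
theorem isCompleteIn_Q (a : ℝ) : IsCompleteIn {1, 2} (Q a) (excW a) := by
  rintro F ⟨hF, hfin⟩ ε hε
  -- A measurable representative, needed for the truncation sets and for additivity of the lower
  -- integral.
  let G : ℝ → Matrix (Fin 2) (Fin 2) ℝ := fun t => Matrix.of fun i j => (hF i j).mk _ t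
  have hG : ∀ i j, Measurable fun t => G t i j := fun i j => (hF i j).measurable_mk
  have hae : ∀ᵐ t, F t = G t := by
    have : ∀ᵐ t, ∀ i j, F t i j = G t i j := by
      rw [ae_all_iff]; intro i
      rw [ae_all_iff]; intro j
      exact (hF i j).ae_eq_mk
    filter_upwards [this] with t ht
    ext1 i j
    exact ht i j
  have hcongr : ∀ S : ℝ → Matrix (Fin 2) (Fin 2) ℝ,
      sqNorm (excW a) (fun t => F t - S t) = sqNorm (excW a) (fun t => G t - S t) := fun S => by
    refine lintegral_congr_ae ?_
    filter_upwards [hae] with t ht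
    rw [ht]
  have hGfin : sqNorm (excW a) G < ⊤ := by
    have := hcongr 0
    simp only [Pi.zero_apply, sub_zero] at this
    rwa [← this]
  -- Both errors are doubled by `sqNorm_add_le`, hence `ε / 4` for each.
  obtain ⟨B, m, hB, hBm, hlt⟩ := exists_bounded_sqNorm_lt a hG hGfin (ε := ε / 4) (by positivity)
  obtain ⟨w, hw⟩ := exists_matPoly_sqNorm_lt a hB hBm (ε := ε / 4) (by positivity)
  obtain ⟨s, A, hs, hsum⟩ := exists_sum_Q_eq a w
  refine ⟨s, A, hs, ?_⟩
  rw [hcongr]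
  simp only [hsum]
  have hle := sqNorm_add_le a (A := fun t => G t - B t)
    (B := fun t => B t - pp a t ^ 2 • evalAt w t) (fun i j => (hG i j).sub (hB i j))
  simp only [sub_add_sub_cancel] at hle
  refine hle.trans_lt ?_
  have e : ENNReal.ofReal ε = 2 * ENNReal.ofReal (ε / 4) + 2 * ENNReal.ofReal (ε / 4) := by
    rw [← ENNReal.ofReal_ofNat, ← ENNReal.ofReal_mul (by positivity),
      ← ENNReal.ofReal_add (by positivity) (by positivity)]
    ring_nf
  rw [e]
  exact ENNReal.add_lt_add ((ENNReal.mul_lt_mul_iff_right (by simp) (by simp)).2 hlt)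
    ((ENNReal.mul_lt_mul_iff_right (by simp) (by simp)).2 hw)

theorem isExceptional_Q (a : ℝ) : IsExceptional {1, 2} (Q a) (excW a) where
  degree := hasNonsingularLeading_Q a
  weight := isWeightMatrix_excW a
  orthogonal n _ k _ hnk := by rw [gram_Q, gram_P, if_neg hnk, zero_mul]
  norm_posDef := norm_Q_posDef a
  complete := isCompleteIn_Q a
  eigen := ⟨1, (toRat (F₂ a))⁻¹ * toRat (G₁ a), constRat L₀, one_ne_zero, eigenvalue,
    fun n _ => Q_eigen a n⟩

end ExcMatrix

end

theorem theorem5p3 (a : ℝ) :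
    ∃ Q : ℕ → ExcMatrix.MatPoly 2,
      (∀ n : ℕ, ExcMatrix.toRat (Q n) = ExcMatrix.P₂ a n) ∧
      ExcMatrix.IsExceptional {1, 2} Q (ExcMatrix.excW a) ∧
      (∀ n : ℕ, n ∉ ({1, 2} : Finset ℕ) →
        ExcMatrix.gram (ExcMatrix.excW a) (Q n) (Q n) =
          (((n : ℝ) - 1) * ((n : ℝ) - 2)) •
            (!![1 / (4 * (3 * a ^ 2 + 2) ^ 2), 0;
                0, 1 / (4 * (3 * a ^ 2 + 2) * (a ^ 2 + 2))] *
              ExcMatrix.gram (ExcMatrix.W a) (ExcMatrix.P a n) (ExcMatrix.P a n))) ∧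
      (∀ n : ℕ,
        ExcMatrix.gram (ExcMatrix.W a) (ExcMatrix.P a n) (ExcMatrix.P a n) =
          (Real.sqrt Real.pi * 2 ^ n * (Nat.factorial n : ℝ)) •
            !![1 + a ^ 2 * ((n : ℝ) + 1) / 2, 0; 0, 1 + a ^ 2 * (n : ℝ) / 2]) :=
  ⟨ExcMatrix.Q a, ExcMatrix.toRat_Q a, ExcMatrix.isExceptional_Q a,
    fun n _ => ExcMatrix.gram_Q_self a n, fun n => by rw [ExcMatrix.gram_P, if_pos rfl]⟩
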